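/- Theorem (Growth rate of sublevel sets). Let $d\ge 1$, let $X\subseteq\mathbb R^d$ be measurable with $0\in X$, and let $V:X\to\mathbb R$ be Lipschitz and positive definite, i.e. $V(0)=0$ and $V(x)>0$ for $x\in X\setminus\{0\}$. Write $S_c=\{x\in X: V(x)\le c\}$, $\partial S_c=\{x\in X: V(x)=c\}$, let $\mu$ be Lebesgue measure and $\mathcal H^{d-1}$ the $(d-1)$-dimensional Hausdorff measure (surface measure, normalized to agree with Lebesgue measure on hyperplanes), and let $G>0$. Say that the growth bound holds at a level $c>0$ if $t\mapsto\mu(S_t)$ is differentiable at $c$ with $$\frac{d}{dc}\mu(S_c)\le G^{-1}\,\mathcal H^{d-1}(\partial S_c),$$ and, for every $\varepsilon>0$, all $\alpha>1$ sufficiently close to $1$ satisfy $$\mu(S_{\alpha c}\setminus S_c)\le c(\alpha-1)G^{-1}\bigl(\mathcal H^{d-1}(\partial S_c)+\varepsilon\bigr).$$ 1. Let $0\le a<b$ and suppose $\|\nabla V(x)\|\ge G$ for almost every $x\in S_b\setminus S_a$ (the gradient of a Lipschitz function exists almost everywhere; for $a=0$ this is the bound on the sublevel set $S_b$). Then for all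 $a\le s\le t\le b$ $$\mu(S_t\setminus S_s)\le G^{-1}\int_s^t\mathcal H^{d-1}(\partial S_r)\,dr,$$ and, if $\mu(S_b)<\infty$, the growth bound holds at almost every level $c\in(a,b)$. 2. Let $c>0$ be such that $S_{c'}$ is compact for some $c'>c$, every point of $\partial S_c$ is an interior point of $X$ near which $V$ is continuously differentiable, and $\|\nabla V\|\ge G$ on $\partial S_c$. Then $\mathcal H^{d-1}(\partial S_c)<\infty$ and the growth bound holds at the level $c$. If moreover $\|\nabla V\|=G$ on $\partial S_c$, then $\frac{d}{dc}\mu(S_c)=G^{-1}\mathcal H^{d-1}(\partial S_c)$. -/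

import Mathlib

open MeasureTheory Filter Topology
open scoped NNReal ENNReal Gradient

noncomputable section

/-- `V` is positive definite on `X`: `V 0 = 0` and `V > 0` on `X \ {0}`. -/
def PosDefOn {d : ℕ} (X : Set (EuclideanSpace ℝ (Fin d))) (V : EuclideanSpace ℝ (Fin d) → ℝ) :
    Prop :=
  (0 : EuclideanSpace ℝ (Fin d)) ∈ X ∧ V 0 = 0 ∧ ∀ x ∈ X, x ≠ 0 → 0 < V x

/-- The sublevel set `S_c(V) = {x ∈ X : V x ≤ c}`. -/
def subLevel {d : ℕ} (X : Set (EuclideanSpace ℝ (Fin d))) (V : EuclideanSpace ℝ (Fin d) → ℝ)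
    (c : ℝ) : Set (EuclideanSpace ℝ (Fin d)) :=
  {x | x ∈ X ∧ V x ≤ c}

/-- The level set `∂S_c(V) = {x ∈ X : V x = c}`. -/
def levelSurface {d : ℕ} (X : Set (EuclideanSpace ℝ (Fin d)))
    (V : EuclideanSpace ℝ (Fin d) → ℝ) (c : ℝ) : Set (EuclideanSpace ℝ (Fin d)) :=
  {x | x ∈ X ∧ V x = c}

/-- Surface measure of the level set `∂S_c(V)`: its `(d-1)`-dimensional Hausdorff measure, in the
normalization that agrees with Lebesgue measure on Euclidean spaces of dimension `d - 1`. -/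
def surfaceArea {d : ℕ} (X : Set (EuclideanSpace ℝ (Fin d)))
    (V : EuclideanSpace ℝ (Fin d) → ℝ) (c : ℝ) : ℝ≥0∞ :=
  μHE[d - 1] (levelSurface X V c)

/-- At the level `c` the volume of the sublevel sets grows at a rate of at most `G⁻¹` times the
surface measure of the level set: the derivative of `t ↦ μ(S_t(V))` at `c` exists and is bounded by
that number, and, to first order as `α` decreases to `1`, the volume of the gap
`S_{αc}(V) \ S_c(V)` is at most `c (α - 1) G⁻¹` times the surface measure. -/
def GrowthBoundAt {d : ℕ} (X : Set (EuclideanSpace ℝ (Fin d)))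
    (V : EuclideanSpace ℝ (Fin d) → ℝ) (G c : ℝ) : Prop :=
  (∃ ρ : ℝ, HasDerivAt (fun t => volume.real (subLevel X V t)) ρ c ∧
    ENNReal.ofReal ρ ≤ ENNReal.ofReal G⁻¹ * surfaceArea X V c) ∧
  ∀ ε : ℝ, 0 < ε → ∀ᶠ α in 𝓝[>] (1 : ℝ),
    volume (subLevel X V (α * c) \ subLevel X V c) ≤
      ENNReal.ofReal (c * (α - 1) * G⁻¹) * (surfaceArea X V c + ENNReal.ofReal ε)

end

/-! The heart is a coarea inequality: where `‖∇ V‖ ≥ G`, the volume of a set times `G` is at most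
the integral over `r` of the areas of its level slices. For a linear form `⟪g, ·⟫` this is Fubini's
theorem with the factor `‖g‖⁻¹`. Where `V` is almost linear with gradient `g`, the map `straighten V
g` is close to the identity and carries level sets of `V` into hyperplanes; being bi-Lipschitz with
constant `κ`, it changes `k`-dimensional Hausdorff measure by a factor of at most `κ ^ k`. A
countable partition into almost linear pieces and `κ → 1` give
`ofReal_mul_measure_le_lintegral_levelSet`.

For almost every level, the volume on `S_b` is pushed forward by `V` to a finite measure on the
line. Its distribution function is differentiable almost everywhere, with the density as derivative,
and the coarea inequality bounds that density (`ae_growthBoundAt`).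

A single level requires continuity in the level, which C¹ regularity supplies. In a chart, a
straightened cutoff function has hyperplane integrals that are continuous in `r`, so the shell
between the levels `c` and `t` has weighted volume about `|t - c|` times a surface integral of `‖∇
V‖⁻¹` (`eventually_setLIntegral_between_levels`). A partition of unity near the compact level set
adds up the charts and identifies the derivative (`hasDerivAt_volumeReal_subLevel`). -/

section GrowthOfSublevelSets

open Module Measure
open scoped RealInnerProductSpace

/-! ### Fubini's theorem along parallel hyperplanes -/

section Slices

variable {E : Type*} [NormedAddCommGroup E] [InnerProductSpace ℝ E]

/-- The vector `v = ‖g‖⁻² g` is normalized so that `⟪g, r • v⟫ = r`: the slice parameter is the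
value of the linear form. -/
theorem range_orthogonal_add_smul {g : E} (hg : g ≠ 0) (r : ℝ) :
    Set.range (fun z : (ℝ ∙ ((‖g‖ ^ 2)⁻¹ • g))ᗮ => (z : E) + r • (‖g‖ ^ 2)⁻¹ • g) =
      {y | ⟪g, y⟫ = r} := by
  have hg2 : ‖g‖ ^ 2 ≠ 0 := by simpa using hg
  ext y
  constructor
  · rintro ⟨z, rfl⟩
    have hz := (Submodule.mem_orthogonal_singleton_iff_inner_right).1 z.2
    rw [real_inner_smul_left] at hz
    have hz' : ⟪g, (z : E)⟫ = 0 := (mul_eq_zero.1 hz).resolve_left (inv_ne_zero hg2)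
    simp only [Set.mem_ofPred_eq]
    rw [inner_add_right, hz', real_inner_smul_right, real_inner_smul_right,
      real_inner_self_eq_norm_sq, inv_mul_cancel₀ hg2]
    ring
  · intro hy
    refine ⟨⟨y - r • (‖g‖ ^ 2)⁻¹ • g, ?_⟩, by simp⟩
    rw [Submodule.mem_orthogonal_singleton_iff_inner_right, real_inner_smul_left, inner_sub_right,
      real_inner_smul_right, real_inner_smul_right, real_inner_self_eq_norm_sq,
      inv_mul_cancel₀ hg2, hy.out]
    ring

theorem enorm_inv_sq_smul_self {g : E} (hg : g ≠ 0) : ‖(‖g‖ ^ 2)⁻¹ • g‖ₑ = ‖g‖ₑ⁻¹ := by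
  have : ‖(‖g‖ ^ 2)⁻¹ • g‖ = ‖g‖⁻¹ := by
    rw [norm_smul, norm_inv, norm_pow, norm_norm]
    have := norm_ne_zero_iff.2 hg
    field_simp
  rw [← ofReal_norm, this, ENNReal.ofReal_inv_of_pos (norm_pos_iff.2 hg), ofReal_norm]


variable [FiniteDimensional ℝ E] [MeasurableSpace E] [BorelSpace E]

/-- Fubini's theorem for the foliation of an inner product space by the hyperplanes orthogonal to
a nonzero vector. -/
theorem lintegral_eq_lintegral_orthogonal_slices {v : E} (hv : v ≠ 0) {f : E → ℝ≥0∞}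
    (hf : Measurable f) :
    ∫⁻ y, f y ∂μHE[finrank ℝ E] = ‖v‖ₑ * ∫⁻ r : ℝ, ∫⁻ z : (ℝ ∙ v)ᗮ, f (z + r • v) := by
  have h := ((ℝ ∙ v).measurePreserving_measurableEquivProd (0 : E)).symm.lintegral_comp hf
  rw [← h]
  have hm : Measurable fun q : (ℝ ∙ v) × (ℝ ∙ v)ᗮ => f ((q.1 : E) + q.2) := by fun_prop
  have h1 : ∀ q : (ℝ ∙ v) × (ℝ ∙ v)ᗮ,
      f (((ℝ ∙ v).measurableEquivProd (0 : E)).symm q) = f ((q.1 : E) + q.2) := by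
    intro q; simp
  simp_rw [h1]
  rw [volume_eq_prod, lintegral_prod _ hm.aemeasurable]
  let e : ℝ ≃L[ℝ] (ℝ ∙ v) := ContinuousLinearEquiv.toSpanNonzeroSingleton ℝ v hv
  have he : MeasurableEmbedding e := e.toHomeomorph.measurableEmbedding
  -- The parametrization `r ↦ r • v` of the line has speed `‖v‖`, which is the Jacobian factor.
  have hvol : (volume : Measure (ℝ ∙ v)) = ‖v‖ₑ • (volume : Measure ℝ).map e := by
    let v' : (ℝ ∙ v) := ⟨v, Submodule.mem_span_singleton_self v⟩
    suffices volume = ‖v'‖ₑ • volume.map e by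
      rw [this]; rfl
    exact volume_eq_of_finrank_eq_one (finrank_span_singleton hv) (by simpa [v'] using hv)
  rw [hvol, lintegral_smul_measure, he.lintegral_map, smul_eq_mul]
  congr 2 with r
  congr 1 with z
  rw [add_comm]
  rfl

/-- Integration over a hyperplane with respect to the surface measure, in coordinates. -/
theorem setLIntegral_hyperplane {g : E} (hg : g ≠ 0) (r : ℝ) {f : E → ℝ≥0∞} (hf : Measurable f) :
    ∫⁻ y in {y | ⟪g, y⟫ = r}, f y ∂μHE[finrank ℝ E - 1] =
      ∫⁻ z : (ℝ ∙ ((‖g‖ ^ 2)⁻¹ • g))ᗮ, f (z + r • (‖g‖ ^ 2)⁻¹ • g) := by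
  have hv : (‖g‖ ^ 2)⁻¹ • g ≠ 0 := smul_ne_zero (inv_ne_zero (by simpa using hg)) hg
  have hiso : Isometry (fun z : (ℝ ∙ ((‖g‖ ^ 2)⁻¹ • g))ᗮ => (z : E) + r • (‖g‖ ^ 2)⁻¹ • g) :=
    (isometry_add_right _).comp isometry_subtype_coe
  have hrank : finrank ℝ (ℝ ∙ ((‖g‖ ^ 2)⁻¹ • g))ᗮ = finrank ℝ E - 1 := by
    rw [← (ℝ ∙ ((‖g‖ ^ 2)⁻¹ • g)).finrank_add_finrank_orthogonal, finrank_span_singleton hv,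
      Nat.add_sub_cancel_left]
  rw [← range_orthogonal_add_smul hg r, ← hiso.map_euclideanHausdorffMeasure,
    lintegral_map hf hiso.continuous.measurable, ← hrank,
    InnerProductSpace.euclideanHausdorffMeasure_eq_volume]

/-- Fubini's theorem for the foliation of an inner product space by the level sets of the linear
form `⟪g, ·⟫`. -/
theorem lintegral_eq_lintegral_hyperplane {g : E} (hg : g ≠ 0) {f : E → ℝ≥0∞}
    (hf : Measurable f) :
    ∫⁻ y, f y ∂μHE[finrank ℝ E] =
      ‖g‖ₑ⁻¹ * ∫⁻ r : ℝ, ∫⁻ y in {y | ⟪g, y⟫ = r}, f y ∂μHE[finrank ℝ E - 1] := by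
  have hv : (‖g‖ ^ 2)⁻¹ • g ≠ 0 := smul_ne_zero (inv_ne_zero (by simpa using hg)) hg
  simp_rw [setLIntegral_hyperplane hg _ hf]
  rw [lintegral_eq_lintegral_orthogonal_slices hv hf, enorm_inv_sq_smul_self hg]

end Slices

/-! ### Straightening level sets into hyperplanes -/

section Straighten

variable {E : Type*} [NormedAddCommGroup E] [InnerProductSpace ℝ E]

/-- The map that moves each point along `g` so as to turn the level sets of `V` into the level sets
of the linear form `⟪g, ·⟫`. -/
noncomputable def straighten (V : E → ℝ) (g x : E) : E :=
  x + (V x - ⟪g, x⟫) • (‖g‖ ^ 2)⁻¹ • g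

theorem inner_straighten (V : E → ℝ) {g : E} (hg : g ≠ 0) (x : E) :
    ⟪g, straighten V g x⟫ = V x := by
  have hg2 : ‖g‖ ^ 2 ≠ 0 := by simpa using hg
  rw [straighten, inner_add_right, real_inner_smul_right, real_inner_smul_right,
    real_inner_self_eq_norm_sq, inv_mul_cancel₀ hg2]
  ring

variable [CompleteSpace E]

/-- The displacement is the error of the linear approximation times a vector of norm `‖g‖⁻¹`, so its
Lipschitz constant is `δ / ‖g‖`. -/
theorem norm_straighten_sub_le {V : E → ℝ} {g : E} {D : Set E} {δ : ℝ≥0} {η : ℝ}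
    (hV : ApproximatesLinearOn V (InnerProductSpace.toDual ℝ E g) D δ) (hg : g ≠ 0)
    (hδ : (δ : ℝ) ≤ η * ‖g‖) {x y : E} (hx : x ∈ D) (hy : y ∈ D) :
    ‖straighten V g x - straighten V g y - (x - y)‖ ≤ η * ‖x - y‖ := by
  have hgp : 0 < ‖g‖ := norm_pos_iff.2 hg
  have h := hV x hx y hy
  rw [InnerProductSpace.toDual_apply_apply, inner_sub_right] at h
  have e : straighten V g x - straighten V g y - (x - y) =
      (V x - V y - (⟪g, x⟫ - ⟪g, y⟫)) • (‖g‖ ^ 2)⁻¹ • g := by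
    simp only [straighten, sub_smul]; abel
  rw [e, norm_smul, norm_smul, norm_inv, norm_pow, norm_norm]
  have : (‖g‖ ^ 2)⁻¹ * ‖g‖ = ‖g‖⁻¹ := by field_simp
  rw [this, mul_inv_le_iff₀ hgp]
  calc _ ≤ _ := h
    _ ≤ η * ‖g‖ * ‖x - y‖ := by gcongr
    _ = _ := by ring

/-- `Φ` distorts distances on `D` by a factor of at most `κ`. -/
structure BiLipschitzOn {X Y : Type*} [PseudoEMetricSpace X] [PseudoEMetricSpace Y]
    (κ : ℝ≥0) (Φ : X → Y) (D : Set X) : Prop where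
  lipschitzOn : LipschitzOnWith κ Φ D
  antilipschitz : AntilipschitzWith κ (D.domRestrict Φ)

/-- With `η = 1 - κ⁻¹` distances shrink at most by `1 - η = κ⁻¹` and grow at most by `1 + η = 2 -
κ⁻¹ ≤ κ`, the last by `(κ - 1)² ≥ 0`. -/
theorem biLipschitzOn_straighten {V : E → ℝ} {g : E} {D : Set E} {δ κ : ℝ≥0} (hκ : 1 ≤ κ)
    (hV : ApproximatesLinearOn V (InnerProductSpace.toDual ℝ E g) D δ) (hg : g ≠ 0)
    (hδ : (δ : ℝ) ≤ (1 - (κ : ℝ)⁻¹) * ‖g‖) : BiLipschitzOn κ (straighten V g) D := by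
  have hκ' : (1 : ℝ) ≤ κ := hκ
  have hκ0 : (0 : ℝ) < κ := by linarith
  have hinv : (κ : ℝ) * (κ : ℝ)⁻¹ = 1 := mul_inv_cancel₀ hκ0.ne'
  constructor
  · refine LipschitzOnWith.of_dist_le_mul fun x hx y hy => ?_
    rw [dist_eq_norm, dist_eq_norm]
    have h := norm_straighten_sub_le hV hg hδ hx hy
    have h2 : 2 - (κ : ℝ)⁻¹ ≤ κ := by
      nlinarith [sq_nonneg ((κ : ℝ) - 1), inv_pos.2 hκ0]
    have := norm_le_norm_add_norm_sub (x - y) (straighten V g x - straighten V g y)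
    rw [norm_sub_rev (x - y) (straighten V g x - straighten V g y)] at this
    nlinarith [norm_nonneg (x - y)]
  · refine AntilipschitzWith.of_le_mul_dist fun x y => ?_
    rw [Subtype.dist_eq, dist_eq_norm, dist_eq_norm]
    simp only [Set.domRestrict_apply]
    have h := norm_straighten_sub_le hV hg hδ x.2 y.2
    have := norm_le_norm_add_norm_sub (straighten V g x - straighten V g y) ((x : E) - y)
    have h3 : (κ : ℝ)⁻¹ * ‖(x : E) - y‖ ≤ ‖straighten V g x - straighten V g y‖ := by linarith
    calc ‖(x : E) - y‖ = κ * ((κ : ℝ)⁻¹ * ‖(x : E) - y‖) := by rw [← mul_assoc, hinv, one_mul]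
      _ ≤ _ := by gcongr

end Straighten

/-! ### Hausdorff measure under bi-Lipschitz maps -/

namespace BiLipschitzOn

variable {X Y : Type*} [EMetricSpace X] [EMetricSpace Y] {κ : ℝ≥0} {Φ : X → Y} {D D' : Set X}

theorem mono (h : BiLipschitzOn κ Φ D) (hD : D' ⊆ D) : BiLipschitzOn κ Φ D' :=
  ⟨h.1.mono hD, fun x y => h.2 ⟨x, hD x.2⟩ ⟨y, hD y.2⟩⟩

theorem injOn (h : BiLipschitzOn κ Φ D) : Set.InjOn Φ D :=
  Set.injOn_iff_injective.2 h.2.injective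

variable [MeasurableSpace X] [BorelSpace X] [MeasurableSpace Y] [BorelSpace Y]

theorem euclideanHausdorffMeasure_image_le (h : BiLipschitzOn κ Φ D) (k : ℕ) :
    μHE[k] (Φ '' D) ≤ (κ : ℝ≥0∞) ^ k * μHE[k] D := by
  have := h.1.hausdorffMeasure_image_le (d := k) (by positivity)
  rw [ENNReal.rpow_natCast] at this
  simp only [euclideanHausdorffMeasure_def, Measure.smul_apply]
  rw [mul_smul_comm]
  gcongr

theorem euclideanHausdorffMeasure_le_image (h : BiLipschitzOn κ Φ D) (k : ℕ) :
    μHE[k] D ≤ (κ : ℝ≥0∞) ^ k * μHE[k] (Φ '' D) := by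
  have := h.2.le_hausdorffMeasure_image (d := k) (by positivity) Set.univ
  rw [ENNReal.rpow_natCast, ← Isometry.hausdorffMeasure_image
    (isometry_subtype_coe (s := D)) (Or.inl (by positivity)), Set.image_univ, Set.image_univ,
    Subtype.range_coe, Set.range_domRestrict] at this
  simp only [euclideanHausdorffMeasure_def, Measure.smul_apply]
  rw [mul_smul_comm]
  gcongr

end BiLipschitzOn

/-- The (lower) Lebesgue integral is countably superadditive. -/
theorem tsum_lintegral_le_lintegral_tsum {α : Type*} [MeasurableSpace α] {μ : Measure α}
    (f : ℕ → α → ℝ≥0∞) : ∑' n, ∫⁻ a, f n a ∂μ ≤ ∫⁻ a, ∑' n, f n a ∂μ := by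
  -- Each function is replaced by a measurable minorant with the same integral.
  choose g hg hgf hfg using fun n => exists_measurable_le_lintegral_eq μ (f n)
  simp_rw [hfg]
  rw [← lintegral_tsum fun n => (hg n).aemeasurable]
  exact lintegral_mono fun a => ENNReal.tsum_le_tsum fun n => hgf n a

/-! ### The coarea inequality -/

section Coarea

variable {E : Type*} [NormedAddCommGroup E] [InnerProductSpace ℝ E]

theorem straighten_image_inter_levelSet {V : E → ℝ} {g : E} (hg : g ≠ 0) (D : Set E) (r : ℝ) :
    straighten V g '' D ∩ {y | ⟪g, y⟫ = r} = straighten V g '' (D ∩ V ⁻¹' {r}) := by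
  ext y
  constructor
  · rintro ⟨⟨x, hx, rfl⟩, h⟩
    exact ⟨x, ⟨hx, by simpa [inner_straighten V hg] using h⟩, rfl⟩
  · rintro ⟨x, ⟨hx, h⟩, rfl⟩
    exact ⟨⟨x, hx, rfl⟩, by simpa [inner_straighten V hg] using h⟩

variable [FiniteDimensional ℝ E] [MeasurableSpace E] [BorelSpace E]

/-- Coarea inequality, up to a factor close to `1`, for a function that is almost linear. -/
theorem enorm_mul_measure_le_of_approximatesLinearOn {V : E → ℝ} {g : E} {D : Set E} {δ κ : ℝ≥0}
    (hκ : 1 ≤ κ) (hD : MeasurableSet D)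
    (hV : ApproximatesLinearOn V (InnerProductSpace.toDual ℝ E g) D δ) (hg : g ≠ 0)
    (hδ : (δ : ℝ) ≤ (1 - (κ : ℝ)⁻¹) * ‖g‖) :
    ‖g‖ₑ * μHE[finrank ℝ E] D ≤ (κ : ℝ≥0∞) ^ finrank ℝ E * (κ : ℝ≥0∞) ^ (finrank ℝ E - 1) *
      ∫⁻ r, μHE[finrank ℝ E - 1] (D ∩ V ⁻¹' {r}) := by
  have hΦ := biLipschitzOn_straighten hκ hV hg hδ
  have hmeas : MeasurableSet (straighten V g '' D) :=
    hD.image_of_continuousOn_injOn hΦ.1.continuousOn hΦ.injOn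
  have hslice : ∀ r, ∫⁻ y in {y | ⟪g, y⟫ = r},
      (straighten V g '' D).indicator 1 y ∂μHE[finrank ℝ E - 1] =
        μHE[finrank ℝ E - 1] (straighten V g '' (D ∩ V ⁻¹' {r})) := by
    intro r
    rw [lintegral_indicator_one hmeas, Measure.restrict_apply hmeas,
      straighten_image_inter_levelSet hg]
  have h1 := lintegral_eq_lintegral_hyperplane hg
    (f := (straighten V g '' D).indicator 1) (measurable_one.indicator hmeas)
  rw [lintegral_indicator_one hmeas] at h1
  simp_rw [hslice] at h1
  have hg0 : ‖g‖ₑ ≠ 0 := by simpa using hg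
  -- Passing from `D` to its image costs `κ ^ n`, Fubini there is exact, and returning to the level
  -- sets costs `κ ^ (n - 1)` on each slice.
  calc ‖g‖ₑ * μHE[finrank ℝ E] D
      ≤ ‖g‖ₑ * ((κ : ℝ≥0∞) ^ finrank ℝ E * μHE[finrank ℝ E] (straighten V g '' D)) := by
        gcongr; exact hΦ.euclideanHausdorffMeasure_le_image _
    _ = (κ : ℝ≥0∞) ^ finrank ℝ E *
          ∫⁻ r, μHE[finrank ℝ E - 1] (straighten V g '' (D ∩ V ⁻¹' {r})) := by
        rw [h1, mul_left_comm, ← mul_assoc ‖g‖ₑ, ENNReal.mul_inv_cancel hg0 (by simp), one_mul]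
    _ ≤ (κ : ℝ≥0∞) ^ finrank ℝ E * ∫⁻ r, (κ : ℝ≥0∞) ^ (finrank ℝ E - 1) *
          μHE[finrank ℝ E - 1] (D ∩ V ⁻¹' {r}) := by
        gcongr with r
        exact (hΦ.mono Set.inter_subset_left).euclideanHausdorffMeasure_image_le _
    _ = _ := by
        rw [lintegral_const_mul' _ _ (by finiteness), mul_assoc]

/-- Coarea inequality for a function with a gradient bounded from below. -/
theorem ofReal_mul_measure_le_lintegral_levelSet {V : E → ℝ} {g : E → E} {A : Set E} {G : ℝ}
    (hG : 0 < G) (hA : MeasurableSet A) (hV : ∀ x ∈ A, HasGradientWithinAt V (g x) A x)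
    (hg : ∀ x ∈ A, G ≤ ‖g x‖) :
    ENNReal.ofReal G * μHE[finrank ℝ E] A ≤ ∫⁻ r, μHE[finrank ℝ E - 1] (A ∩ V ⁻¹' {r}) := by
  rcases A.eq_empty_or_nonempty with rfl | hne
  · simp
  set n := finrank ℝ E
  set I := ∫⁻ r, μHE[n - 1] (A ∩ V ⁻¹' {r})
  have key : ∀ κ : ℝ≥0, 1 < κ →
      ENNReal.ofReal G * μHE[n] A ≤ (κ : ℝ≥0∞) ^ n * (κ : ℝ≥0∞) ^ (n - 1) * I := by
    classical
    intro κ hκ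
    have hη : 0 < 1 - κ⁻¹ := tsub_pos_of_lt (inv_lt_one_of_one_lt₀ hκ)
    obtain ⟨t, L, htd, htm, hAt, happ, hL⟩ :=
      exists_partition_approximatesLinearOn_of_hasFDerivWithinAt V A
        (fun x => InnerProductSpace.toDual ℝ E (g x)) (fun x hx => (hV x hx).hasFDerivWithinAt)
        -- The partition needs a nonzero tolerance at every `L`. The value `1` is never used: each
        -- piece has as its `L` the gradient at a point of `A`, which is nonzero.
        (fun L => if L = 0 then 1 else (1 - κ⁻¹) * ‖L‖₊) (by
          intro L
          split_ifs with h
          · exact one_ne_zero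
          · exact mul_ne_zero hη.ne' (by simpa using h))
    choose y hyA hLy using hL hne
    have hdisj : Pairwise (Function.onFun Disjoint fun k => A ∩ t k) := fun i j hij =>
      (htd hij).mono Set.inter_subset_right Set.inter_subset_right
    have hAU : A = ⋃ k, A ∩ t k := by rw [← Set.inter_iUnion, Set.inter_eq_left.2 hAt]
    have hpiece : ∀ k, ENNReal.ofReal G * μHE[n] (A ∩ t k) ≤
        (κ : ℝ≥0∞) ^ n * (κ : ℝ≥0∞) ^ (n - 1) * ∫⁻ r, μHE[n - 1] (A ∩ t k ∩ V ⁻¹' {r}) := by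
      intro k
      have hGk := hg _ (hyA k)
      have hg0 : g (y k) ≠ 0 := norm_pos_iff.1 (hG.trans_le hGk)
      have happk := happ k
      have hL0 : L k ≠ 0 := by rw [hLy k]; simpa using hg0
      rw [if_neg hL0] at happk
      have hnorm : ‖L k‖ = ‖g (y k)‖ := by rw [hLy k]; simp
      rw [hLy k] at happk
      refine le_trans ?_ (enorm_mul_measure_le_of_approximatesLinearOn hκ.le
        (hA.inter (htm k)) happk hg0 ?_)
      · gcongr
        rw [← ofReal_norm]
        exact ENNReal.ofReal_le_ofReal hGk
      · rw [← hLy k, NNReal.coe_mul, coe_nnnorm, hnorm, NNReal.coe_sub (inv_le_one_of_one_le₀ hκ.le)]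
        simp
    calc ENNReal.ofReal G * μHE[n] A = ∑' k, ENNReal.ofReal G * μHE[n] (A ∩ t k) := by
          rw [ENNReal.tsum_mul_left, ← measure_iUnion hdisj fun k => hA.inter (htm k), ← hAU]
      _ ≤ ∑' k, (κ : ℝ≥0∞) ^ n * (κ : ℝ≥0∞) ^ (n - 1) *
            ∫⁻ r, μHE[n - 1] (A ∩ t k ∩ V ⁻¹' {r}) := ENNReal.tsum_le_tsum hpiece
      _ = (κ : ℝ≥0∞) ^ n * (κ : ℝ≥0∞) ^ (n - 1) *
            ∑' k, ∫⁻ r, μHE[n - 1] (A ∩ t k ∩ V ⁻¹' {r}) := ENNReal.tsum_mul_left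
      -- Superadditivity of the lower integral suffices here, so the slice areas need not be
      -- measurable in `r`.
      _ ≤ (κ : ℝ≥0∞) ^ n * (κ : ℝ≥0∞) ^ (n - 1) *
            ∫⁻ r, ∑' k, μHE[n - 1] (A ∩ t k ∩ V ⁻¹' {r}) := by
          gcongr; exact tsum_lintegral_le_lintegral_tsum _
      _ ≤ _ := by
          refine mul_le_mul_right (lintegral_mono fun r => ?_) _
          have hVc : ContinuousOn V A := fun x hx => (hV x hx).continuousWithinAt
          have hm : MeasurableSet (A ∩ V ⁻¹' {r}) := by
            obtain ⟨u, hu, h⟩ := continuousOn_iff_isClosed.1 hVc {r} isClosed_singleton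
            rw [Set.inter_comm, h]
            exact hu.measurableSet.inter hA
          rw [← measure_iUnion]
          · exact measure_mono (Set.iUnion_subset fun k =>
              Set.inter_subset_inter_left _ Set.inter_subset_left)
          · exact fun i j hij => (hdisj hij).mono Set.inter_subset_left Set.inter_subset_left
          · intro k
            rw [Set.inter_right_comm]
            exact hm.inter (htm k)
  have hlim : Tendsto (fun κ : ℝ≥0 => (κ : ℝ≥0∞) ^ n * (κ : ℝ≥0∞) ^ (n - 1) * I) (𝓝[>] 1)
      (𝓝 (1 * I)) := by
    refine ENNReal.Tendsto.mul_const ?_ (Or.inl one_ne_zero)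
    have : Continuous fun κ : ℝ≥0 => ((κ ^ n * κ ^ (n - 1) : ℝ≥0) : ℝ≥0∞) := by fun_prop
    have h := this.tendsto 1
    simp only [one_pow, mul_one, ENNReal.coe_one, ENNReal.coe_mul, ENNReal.coe_pow] at h
    exact h.mono_left nhdsWithin_le_nhds
  rw [one_mul] at hlim
  exact ge_of_tendsto hlim (eventually_nhdsWithin_of_forall key)

/-- Coarea inequality for a Lipschitz function, the gradient being bounded from below almost
everywhere. -/
theorem LipschitzOnWith.measure_le_lintegral_levelSet {V : E → ℝ} {X A : Set E} {K : ℝ≥0} {G : ℝ}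
    (hV : LipschitzOnWith K V X) (hG : 0 < G) (hAX : A ⊆ X) (hA : MeasurableSet A)
    (hg : ∀ᵐ x ∂μHE[finrank ℝ E].restrict A, ∀ g, HasGradientWithinAt V g X x → G ≤ ‖g‖) :
    μHE[finrank ℝ E] A ≤
      ENNReal.ofReal G⁻¹ * ∫⁻ r, μHE[finrank ℝ E - 1] (A ∩ V ⁻¹' {r}) := by
  rw [ae_restrict_iff' hA] at hg
  have hdiff := hV.ae_differentiableWithinAt_of_mem (μ := μHE[finrank ℝ E])
  have hgood : ∀ᵐ x ∂μHE[finrank ℝ E], x ∈ A →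
      ∃ g, HasGradientWithinAt V g X x ∧ G ≤ ‖g‖ := by
    filter_upwards [hg, hdiff] with x hx hd hxA
    have := hasFDerivWithinAt_iff_hasGradientWithinAt.1 (hd (hAX hxA)).hasFDerivWithinAt
    exact ⟨_, this, hx hxA _ this⟩
  -- The bad points are enclosed in a measurable null set. Removing it preserves the volume and can
  -- only shrink the level slices, which is the harmless direction.
  obtain ⟨N, hN, hNm, hN0⟩ := exists_measurable_superset_of_null (ae_iff.1 hgood)
  have hA' : ∀ x, ∃ g, x ∈ A \ N → HasGradientWithinAt V g X x ∧ G ≤ ‖g‖ := by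
    intro x
    by_cases h : x ∈ A \ N
    · by_contra hcon
      push Not at hcon
      refine h.2 (hN fun hx => ?_)
      obtain ⟨g, hg1, hg2⟩ := hx h.1
      exact absurd hg2 (not_le.2 ((hcon g).2 hg1))
    · exact ⟨0, fun h' => absurd h' h⟩
  choose g hg' using hA'
  have h := ofReal_mul_measure_le_lintegral_levelSet hG (hA.diff hNm)
    (fun x hx => HasFDerivWithinAt.mono (hg' x hx).1.hasFDerivWithinAt
      (Set.sdiff_subset.trans hAX)) (fun x hx => (hg' x hx).2)
  rw [measure_sdiff_null hN0] at h
  have hG0 : ENNReal.ofReal G ≠ 0 := by simpa using hG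
  rw [ENNReal.ofReal_inv_of_pos hG, ← ENNReal.mul_le_iff_le_inv hG0 (by simp)]
  refine h.trans (lintegral_mono fun r => measure_mono ?_)
  exact Set.inter_subset_inter_left _ Set.sdiff_subset

end Coarea

/-- The distribution function of a finite measure on the line is differentiable almost everywhere,
the derivative being the density of the measure. -/
theorem ae_hasDerivAt_measureReal_Iic (ν : Measure ℝ) [IsFiniteMeasure ν] :
    ∀ᵐ x, HasDerivAt (fun t => ν.real (Set.Iic t)) (ν.rnDeriv volume x).toReal x := by
  let F : StieltjesFunction ℝ :=
    { toFun := fun t => ν.real (Set.Iic t)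
      mono' := fun s t h => measureReal_mono (Set.Iic_subset_Iic.2 h)
      right_continuous' := by
        intro x
        rw [← continuousWithinAt_Ioi_iff_Ici]
        have h := tendsto_measure_biInter_gt (μ := ν) (s := fun t : ℝ => Set.Iic t) (a := x)
          (fun r _ => measurableSet_Iic.nullMeasurableSet)
          (fun i j _ h => Set.Iic_subset_Iic.2 h) ⟨x + 1, by simp, measure_ne_top _ _⟩
        have hI : ⋂ r > x, Set.Iic r = Set.Iic x := by
          ext y
          simp only [Set.mem_iInter, Set.mem_Iic]
          exact ⟨fun h => le_of_forall_gt_imp_ge_of_dense fun r hr => h r hr,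
            fun h r hr => h.trans hr.le⟩
        rw [hI] at h
        exact (ENNReal.tendsto_toReal (measure_ne_top _ _)).comp h }
  have hF : F.measure = ν := by
    refine Measure.ext_of_Ioc _ _ fun a b hab => ?_
    rw [F.measure_Ioc]
    change ENNReal.ofReal (ν.real (Set.Iic b) - ν.real (Set.Iic a)) = _
    rw [← measureReal_sdiff (Set.Iic_subset_Iic.2 hab.le) measurableSet_Iic, Set.Iic_sdiff_Iic,
      ofReal_measureReal]
  have h := F.ae_hasDerivAt
  rw [hF] at h
  exact h

/-! ### The growth bound at almost every level -/

section SubLevel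

variable {d : ℕ} {X : Set (EuclideanSpace ℝ (Fin d))} {V : EuclideanSpace ℝ (Fin d) → ℝ}

theorem subLevel_mono {s t : ℝ} (h : s ≤ t) : subLevel X V s ⊆ subLevel X V t :=
  fun _ hx => ⟨hx.1, hx.2.trans h⟩

theorem subLevel_sdiff_subLevel (s t : ℝ) :
    subLevel X V t \ subLevel X V s = X ∩ V ⁻¹' Set.Ioc s t := by
  ext x
  constructor
  · rintro ⟨⟨hx, ht⟩, hs⟩
    exact ⟨hx, lt_of_not_ge fun h => hs ⟨hx, h⟩, ht⟩
  · rintro ⟨hx, hs, ht⟩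
    exact ⟨⟨hx, ht⟩, fun h => not_le.2 hs h.2⟩

/-- `V` is controlled only on `X`; a Lipschitz extension to the whole space is Borel and has the
same preimages within `X`. -/
theorem LipschitzOnWith.measurableSet_inter_preimage {K : ℝ≥0} (hLip : LipschitzOnWith K V X)
    (hX : MeasurableSet X) {B : Set ℝ} (hB : MeasurableSet B) : MeasurableSet (X ∩ V ⁻¹' B) := by
  obtain ⟨W, hW, hVW⟩ := hLip.extend_real
  have : X ∩ V ⁻¹' B = X ∩ W ⁻¹' B := by
    ext x
    constructor
    · rintro ⟨hx, h⟩
      exact ⟨hx, by simpa [← hVW hx] using h⟩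
    · rintro ⟨hx, h⟩
      exact ⟨hx, by simpa [hVW hx] using h⟩
  rw [this]
  exact hX.inter (hW.continuous.measurable hB)

/-- Intervals `B` give the integrated bound; general Borel sets are needed to compare densities. -/
theorem volume_inter_preimage_le_lintegral_surfaceArea {K : ℝ≥0} (hLip : LipschitzOnWith K V X)
    (hX : MeasurableSet X) {G : ℝ} (hG : 0 < G) {B : Set ℝ} (hB : MeasurableSet B)
    (hg : ∀ᵐ x ∂volume.restrict (X ∩ V ⁻¹' B), ∀ g, HasGradientWithinAt V g X x → G ≤ ‖g‖) :
    volume (X ∩ V ⁻¹' B) ≤ ENNReal.ofReal G⁻¹ * ∫⁻ r in B, surfaceArea X V r := by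
  have hfin : finrank ℝ (EuclideanSpace ℝ (Fin d)) = d := finrank_euclideanSpace_fin
  have hvol := EuclideanSpace.euclideanHausdorffMeasure_eq_volume d
  have h := hLip.measure_le_lintegral_levelSet hG Set.inter_subset_left
    (hLip.measurableSet_inter_preimage hX hB) (by rw [hfin, hvol]; exact hg)
  rw [hfin, hvol] at h
  refine h.trans ?_
  refine mul_le_mul_right ?_ _
  rw [← lintegral_indicator hB]
  refine lintegral_mono fun r => ?_
  by_cases hr : r ∈ B
  · rw [Set.indicator_of_mem hr]
    exact measure_mono fun x hx => ⟨hx.1.1, hx.2⟩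
  · rw [Set.indicator_of_notMem hr]
    have : X ∩ V ⁻¹' B ∩ V ⁻¹' {r} = ∅ := by
      ext x
      simp only [Set.mem_inter_iff, Set.mem_preimage, Set.mem_singleton_iff,
        Set.mem_empty_iff_false, iff_false]
      rintro ⟨⟨-, h1⟩, rfl⟩
      exact hr h1
    rw [this, measure_empty]

theorem volumeReal_subLevel_sub {K : ℝ≥0} (hLip : LipschitzOnWith K V X) (hX : MeasurableSet X)
    {s t : ℝ} (hst : s ≤ t) (hfin : volume (subLevel X V t) ≠ ∞) :
    volume.real (subLevel X V t) - volume.real (subLevel X V s) =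
      volume.real (subLevel X V t \ subLevel X V s) := by
  rw [measureReal_sdiff (subLevel_mono hst) (hLip.measurableSet_inter_preimage hX
    (measurableSet_Iic (a := s))) hfin]

/-- The growth bound for the gaps between sublevel sets follows from that for the derivative. -/
theorem growthBoundAt_of_hasDerivAt {K : ℝ≥0} (hLip : LipschitzOnWith K V X) (hX : MeasurableSet X)
    {G c c' ρ : ℝ} (hG : 0 < G) (hc : 0 < c) (hcc' : c < c')
    (hfin : volume (subLevel X V c') ≠ ∞)
    (hder : HasDerivAt (fun t => volume.real (subLevel X V t)) ρ c)
    (hρ : ENNReal.ofReal ρ ≤ ENNReal.ofReal G⁻¹ * surfaceArea X V c) : GrowthBoundAt X V G c := by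
  refine ⟨⟨ρ, hder, hρ⟩, fun ε hε => ?_⟩
  have hGi : 0 < G⁻¹ := inv_pos.2 hG
  by_cases htop : surfaceArea X V c = ∞
  · filter_upwards [self_mem_nhdsWithin] with α hα
    have : 0 < c * (α - 1) * G⁻¹ := mul_pos (mul_pos hc (sub_pos.2 hα)) hGi
    rw [htop, _root_.top_add, ENNReal.mul_top (by simpa using this)]
    exact le_top
  set H := (surfaceArea X V c).toReal
  have hH0 : 0 ≤ H := ENNReal.toReal_nonneg
  have hH : surfaceArea X V c = ENNReal.ofReal H := (ENNReal.ofReal_toReal htop).symm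
  -- The slack `ε` makes the bound on the derivative strict, so it passes to difference quotients
  -- near `c`, taken at `t = α * c`.
  have hρ' : ρ < G⁻¹ * (H + ε) := by
    rw [hH, ← ENNReal.ofReal_mul hGi.le, ENNReal.ofReal_le_ofReal_iff (by positivity)] at hρ
    nlinarith
  have hslope : ∀ᶠ t in 𝓝[>] c, slope (fun t => volume.real (subLevel X V t)) c t <
      G⁻¹ * (H + ε) :=
    ((hasDerivAt_iff_tendsto_slope.1 hder).mono_left
      (nhdsWithin_mono _ fun t (ht : c < t) => ht.ne')).eventually_lt_const hρ'
  have hα : Tendsto (fun α : ℝ => α * c) (𝓝[>] 1) (𝓝[>] c) := by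
    refine tendsto_nhdsWithin_iff.2 ⟨?_, ?_⟩
    · have : Tendsto (fun α : ℝ => α * c) (𝓝 1) (𝓝 (1 * c)) := by
        exact (continuous_id.mul continuous_const).tendsto 1
      rw [one_mul] at this
      exact this.mono_left nhdsWithin_le_nhds
    · filter_upwards [self_mem_nhdsWithin] with α hα
      exact (lt_mul_iff_one_lt_left hc).2 hα
  filter_upwards [hα.eventually hslope, hα.eventually (Ioo_mem_nhdsGT hcc')] with α h1 h2
  have hfin' := measure_ne_top_of_subset (subLevel_mono h2.2.le) hfin
  have hpos : 0 < α * c - c := sub_pos.2 h2.1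
  rw [slope_def_field, div_lt_iff₀ hpos, volumeReal_subLevel_sub hLip hX h2.1.le hfin'] at h1
  rw [hH, ← ENNReal.ofReal_add hH0 hε.le, ← ENNReal.ofReal_mul (by
    have : c * (α - 1) = α * c - c := by ring
    rw [this]; positivity),
    ← ofReal_measureReal (measure_ne_top_of_subset Set.sdiff_subset hfin')]
  refine ENNReal.ofReal_le_ofReal (h1.le.trans (le_of_eq ?_))
  ring

/-- At almost every level the growth bound follows from the coarea inequality. -/
theorem ae_growthBoundAt {K : ℝ≥0} (hLip : LipschitzOnWith K V X) (hX : MeasurableSet X)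
    {G a b : ℝ} (hG : 0 < G) (ha : 0 ≤ a)
    (hg : ∀ᵐ x ∂volume.restrict (subLevel X V b \ subLevel X V a),
      ∀ g, HasGradientWithinAt V g X x → G ≤ ‖g‖)
    (hfin : volume (subLevel X V b) ≠ ∞) :
    ∀ᵐ c ∂volume.restrict (Set.Ioo a b), GrowthBoundAt X V G c := by
  obtain ⟨W, hW, hVW⟩ := hLip.extend_real
  have hWm : Measurable W := hW.continuous.measurable
  have hS : MeasurableSet (subLevel X V b) :=
    hLip.measurableSet_inter_preimage hX (measurableSet_Iic (a := b))
  have : IsFiniteMeasure (volume.restrict (subLevel X V b)) :=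
    ⟨by simpa using hfin.lt_top⟩
  set ν : Measure ℝ := (volume.restrict (subLevel X V b)).map W
  have hν : ∀ B, MeasurableSet B → B ⊆ Set.Iic b → ν B = volume (X ∩ V ⁻¹' B) := by
    intro B hB hBb
    rw [Measure.map_apply hWm hB, Measure.restrict_apply (hWm hB)]
    congr 1
    ext x
    constructor
    · rintro ⟨h1, h2⟩
      exact ⟨h2.1, by simpa [hVW h2.1] using h1⟩
    · rintro ⟨h1, h2⟩
      exact ⟨by simpa [← hVW h1] using h2, h1, hBb h2⟩
  have hdens : ∀ᵐ c ∂volume.restrict (Set.Ioo a b),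
      ν.rnDeriv volume c ≤ ENNReal.ofReal G⁻¹ * surfaceArea X V c := by
    refine ae_le_of_forall_setLIntegral_le_of_sigmaFinite (measurable_rnDeriv _ _) fun B hB _ => ?_
    rw [Measure.restrict_restrict hB]
    have hB' : MeasurableSet (B ∩ Set.Ioo a b) := hB.inter measurableSet_Ioo
    -- A singular part of `ν` may be dropped: only an upper bound for the density is needed.
    refine (setLIntegral_rnDeriv_le _).trans ?_
    rw [hν _ hB' fun r hr => hr.2.2.le, lintegral_const_mul' _ _ ENNReal.ofReal_ne_top]
    refine volume_inter_preimage_le_lintegral_surfaceArea hLip hX hG hB' ?_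
    refine ae_restrict_of_ae_restrict_of_subset ?_ hg
    rw [subLevel_sdiff_subLevel]
    exact Set.inter_subset_inter_right _
      (Set.preimage_mono fun r hr => ⟨hr.2.1, hr.2.2.le⟩)
  filter_upwards [hdens, ae_restrict_of_ae (ae_hasDerivAt_measureReal_Iic ν),
    ae_restrict_mem measurableSet_Ioo] with c hc hder hcab
  refine growthBoundAt_of_hasDerivAt hLip hX hG (ha.trans_lt hcab.1) hcab.2 hfin
    (hder.congr_of_eventuallyEq ?_) (ENNReal.ofReal_toReal_le.trans hc)
  -- The distribution function of `ν` is the volume of `S_t` only for `t ≤ b`, which is enough near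
  -- `c < b`.
  filter_upwards [Iio_mem_nhds hcab.2] with t ht
  rw [measureReal_def, measureReal_def,
    hν _ measurableSet_Iic (Set.Iic_subset_Iic.2 (le_of_lt ht))]
  rfl

end SubLevel

/-! ### Transport of weighted integrals by the straightening map -/

namespace BiLipschitzOn

variable {X Y : Type*} [EMetricSpace X] [EMetricSpace Y] {κ : ℝ≥0} {Φ : X → Y} {D : Set X}
  [MeasurableSpace X] [BorelSpace X] [MeasurableSpace Y] [BorelSpace Y]

theorem map_restrict_apply (h : BiLipschitzOn κ Φ D) (hD : MeasurableSet D) (k : ℕ) {B : Set Y}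
    (hB : MeasurableSet B) : (μHE[k].restrict D).map Φ B = μHE[k] (D ∩ Φ ⁻¹' B) := by
  rw [Measure.map_apply_of_aemeasurable (h.1.continuousOn.aemeasurable hD) hB,
    Measure.restrict_apply' hD, Set.inter_comm]

/-- The estimate for sets says that the push-forward of the measure on `D` is dominated by `κ ^ k`
times the measure on `Φ '' D`; integrating `f` against both gives the claim. -/
theorem setLIntegral_comp_le (h : BiLipschitzOn κ Φ D) (hD : MeasurableSet D) (k : ℕ)
    {f : Y → ℝ≥0∞} (hf : Measurable f) :
    ∫⁻ x in D, f (Φ x) ∂μHE[k] ≤ (κ : ℝ≥0∞) ^ k * ∫⁻ y in Φ '' D, f y ∂μHE[k] := by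
  have hle : (μHE[k].restrict D).map Φ ≤ (κ : ℝ≥0∞) ^ k • μHE[k].restrict (Φ '' D) := by
    refine Measure.le_iff.2 fun B hB => ?_
    rw [h.map_restrict_apply hD k hB, Measure.smul_apply, Measure.restrict_apply hB, smul_eq_mul,
      Set.inter_comm B, ← Set.image_inter_preimage]
    exact (h.mono Set.inter_subset_left).euclideanHausdorffMeasure_le_image k
  rw [← lintegral_map' hf.aemeasurable (h.1.continuousOn.aemeasurable hD), ← smul_eq_mul,
    ← lintegral_smul_measure]
  exact lintegral_mono' hle le_rfl

theorem setLIntegral_image_le (h : BiLipschitzOn κ Φ D) (hD : MeasurableSet D) (k : ℕ)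
    {f : Y → ℝ≥0∞} (hf : Measurable f) :
    ∫⁻ y in Φ '' D, f y ∂μHE[k] ≤ (κ : ℝ≥0∞) ^ k * ∫⁻ x in D, f (Φ x) ∂μHE[k] := by
  have hle : μHE[k].restrict (Φ '' D) ≤ (κ : ℝ≥0∞) ^ k • (μHE[k].restrict D).map Φ := by
    refine Measure.le_iff.2 fun B hB => ?_
    rw [Measure.smul_apply, h.map_restrict_apply hD k hB, Measure.restrict_apply hB, smul_eq_mul,
      Set.inter_comm B, ← Set.image_inter_preimage]
    exact (h.mono Set.inter_subset_left).euclideanHausdorffMeasure_image_le k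
  rw [← lintegral_map' hf.aemeasurable (h.1.continuousOn.aemeasurable hD), ← smul_eq_mul,
    ← lintegral_smul_measure]
  exact lintegral_mono' hle le_rfl

end BiLipschitzOn

/-- This localizes integrals to a chart `U`; `S` itself may be non-measurable. -/
theorem setLIntegral_eq_of_eq_zero_off {α : Type*} [MeasurableSpace α] {μ : Measure α}
    {U : Set α} (hU : MeasurableSet U) (S : Set α) {f : α → ℝ≥0∞} (hf : ∀ x ∉ U, f x = 0) :
    ∫⁻ x in S, f x ∂μ = ∫⁻ x in U ∩ S, f x ∂μ := by
  rw [← Measure.restrict_restrict hU, ← lintegral_indicator hU]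
  congr 1
  ext x
  by_cases hx : x ∈ U
  · rw [Set.indicator_of_mem hx]
  · rw [Set.indicator_of_notMem hx, hf x hx]

section Transport

variable {E : Type*} [NormedAddCommGroup E] [InnerProductSpace ℝ E] [CompleteSpace E]

/-- A compactly supported function on the domain of a straightening map can be pushed forward. -/
theorem exists_continuous_comp_straighten {V : E → ℝ} {g : E} {U : Set E} {δ κ : ℝ≥0}
    (hκ : 1 ≤ κ) (hU : IsOpen U)
    (hV : ApproximatesLinearOn V (InnerProductSpace.toDual ℝ E g) U δ) (hg : g ≠ 0)
    (hδ : (δ : ℝ) ≤ (1 - (κ : ℝ)⁻¹) * ‖g‖) {φ : E → ℝ} (hφ : Continuous φ)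
    (hφs : HasCompactSupport φ) (hφU : tsupport φ ⊆ U) (hφ0 : ∀ x, 0 ≤ φ x) :
    ∃ ψ : E → ℝ, Continuous ψ ∧ HasCompactSupport ψ ∧ (∀ y, 0 ≤ ψ y) ∧
      (∀ x ∈ U, ψ (straighten V g x) = φ x) ∧ ∀ y ∉ straighten V g '' U, ψ y = 0 := by
  classical
  have : Nontrivial E := ⟨⟨g, 0, hg⟩⟩
  have hκ0 : 0 < κ := zero_lt_one.trans_le hκ
  -- The map differs from the identity by a Lipschitz error of constant `1 - κ⁻¹ < 1`, so it is a
  -- homeomorphism from `U` onto an open set.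
  have happ : ApproximatesLinearOn (straighten V g)
      ((ContinuousLinearEquiv.refl ℝ E : E ≃L[ℝ] E) : E →L[ℝ] E) U (1 - κ⁻¹) := by
    intro x hx y hy
    have := norm_straighten_sub_le hV hg hδ hx hy
    rw [NNReal.coe_sub (inv_le_one_of_one_le₀ hκ)]
    simpa using this
  let e := happ.toOpenPartialHomeomorph (straighten V g) U (Or.inr (by
    have h1 : ‖((ContinuousLinearEquiv.refl ℝ E).symm : E →L[ℝ] E)‖₊ = 1 := by
      rw [ContinuousLinearEquiv.refl_symm, ContinuousLinearEquiv.coe_refl]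
      exact ContinuousLinearMap.nnnorm_id
    rw [h1, inv_one]
    exact tsub_lt_self zero_lt_one (inv_pos.2 hκ0))) hU
  have hes : e.source = U := rfl
  have het : e.target = straighten V g '' U := rfl
  have hee : ∀ x, e x = straighten V g x := fun _ => rfl
  have hK : IsCompact (e '' tsupport φ) :=
    hφs.isCompact.image_of_continuousOn (e.continuousOn.mono hφU)
  -- The extension by zero is continuous because the image of `tsupport φ` is compact, hence closed,
  -- and lies inside the open target.
  let ψ : E → ℝ := fun y => if y ∈ e.target then φ (e.symm y) else 0
  have hψK : ∀ y ∉ e '' tsupport φ, ψ y = 0 := by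
    intro y hy
    by_cases hyt : y ∈ e.target
    · simp only [ψ, if_pos hyt]
      by_contra hne
      exact hy ⟨e.symm y, subset_tsupport _ hne, e.right_inv hyt⟩
    · simp only [ψ, if_neg hyt]
  refine ⟨ψ, ?_, HasCompactSupport.intro hK hψK, ?_, ?_, ?_⟩
  · refine continuous_iff_continuousAt.2 fun y => ?_
    by_cases hy : y ∈ e.target
    · have h1 : ContinuousAt (fun y => φ (e.symm y)) y :=
        hφ.continuousAt.comp (e.continuousAt_symm hy)
      refine h1.congr ?_
      filter_upwards [e.open_target.mem_nhds hy] with z hz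
      simp only [ψ, if_pos hz]
    · have hyK : y ∉ e '' tsupport φ := by
        rintro ⟨x, hx, rfl⟩
        exact hy (e.map_source (hφU hx))
      have h1 : ContinuousAt (fun _ : E => (0 : ℝ)) y := continuousAt_const
      refine h1.congr ?_
      filter_upwards [hK.isClosed.isOpen_compl.mem_nhds hyK] with z hz
      exact (hψK z hz).symm
  · intro y
    simp only [ψ]
    split_ifs
    exacts [hφ0 _, le_rfl]
  · intro x hx
    have : e x ∈ e.target := e.map_source hx
    simp only [ψ, ← hee, if_pos this, e.left_inv (show x ∈ e.source from hx)]
  · intro y hy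
    exact if_neg hy

end Transport

/-! ### Continuity of hyperplane integrals in the level -/

section SliceContinuity

variable {E : Type*} [NormedAddCommGroup E] [InnerProductSpace ℝ E] [FiniteDimensional ℝ E]
  [MeasurableSpace E] [BorelSpace E]

/-- The integral of a compactly supported function over parallel hyperplanes is finite and varies
continuously. -/
theorem continuous_setLIntegral_hyperplane {g : E} (hg : g ≠ 0) {ψ : E → ℝ} (hψ : Continuous ψ)
    (hψs : HasCompactSupport ψ) (hψ0 : ∀ y, 0 ≤ ψ y) :
    (Continuous fun r : ℝ =>
      ∫⁻ y in {y | ⟪g, y⟫ = r}, ENNReal.ofReal (ψ y) ∂μHE[finrank ℝ E - 1]) ∧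
    ∀ r : ℝ, ∫⁻ y in {y | ⟪g, y⟫ = r}, ENNReal.ofReal (ψ y) ∂μHE[finrank ℝ E - 1] ≠ ∞ := by
  set v := (‖g‖ ^ 2)⁻¹ • g with hv
  let P := (ℝ ∙ v)ᗮ.orthogonalProjectionOnto
  -- One compact set contains the supports of all slices, independently of `r`; this gives
  -- continuity of the parametric integral.
  have hk : IsCompact (P '' tsupport ψ) := hψs.isCompact.image P.continuous
  have hzero : ∀ (r : ℝ) (z : (ℝ ∙ v)ᗮ), z ∉ P '' tsupport ψ → ψ (z + r • v) = 0 := by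
    intro r z hz
    by_contra hne
    refine hz ⟨z + r • v, subset_tsupport _ hne, ?_⟩
    rw [map_add, map_smul]
    have h1 : P (z : E) = z := Submodule.orthogonalProjectionOnto_mem_subspace_eq_self z
    have h2 : P v = 0 :=
      Submodule.orthogonalProjectionOnto_orthogonalComplement_singleton_eq_zero v
    rw [h1, h2, smul_zero, add_zero]
  have hcont : Continuous fun r : ℝ => ∫ z : (ℝ ∙ v)ᗮ, ψ (z + r • v) := by
    rw [← continuousOn_univ]
    refine continuousOn_integral_of_compact_support hk ?_ fun r z _ hz => hzero r z hz
    exact Continuous.continuousOn (by fun_prop)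
  have heq : ∀ r : ℝ, ∫⁻ y in {y | ⟪g, y⟫ = r}, ENNReal.ofReal (ψ y) ∂μHE[finrank ℝ E - 1] =
      ENNReal.ofReal (∫ z : (ℝ ∙ v)ᗮ, ψ (z + r • v)) := by
    intro r
    rw [setLIntegral_hyperplane hg r hψ.measurable.ennreal_ofReal,
      ofReal_integral_eq_lintegral_ofReal _ (ae_of_all _ fun z => hψ0 _)]
    exact Continuous.integrable_of_hasCompactSupport (by fun_prop)
      (HasCompactSupport.intro hk (hzero r))
  simp_rw [heq]
  exact ⟨ENNReal.continuous_ofReal.comp hcont, fun r => ENNReal.ofReal_ne_top⟩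

end SliceContinuity

/-- Averages of a continuous function over short intervals are close to its value. -/
theorem eventually_setLIntegral_uIoc {m : ℝ → ℝ≥0∞} {c : ℝ} (hm : ContinuousAt m c)
    (hc : m c ≠ ∞) {ε : ℝ≥0∞} (hε : ε ≠ 0) :
    ∀ᶠ t in 𝓝 c,
      ∫⁻ r in Set.uIoc c t, m r ≤ ENNReal.ofReal |t - c| * (m c + ε) ∧
      ENNReal.ofReal |t - c| * m c ≤
        (∫⁻ r in Set.uIoc c t, m r) + ENNReal.ofReal |t - c| * ε := by
  obtain ⟨η, hη, h⟩ := Metric.eventually_nhds_iff.1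
    ((ENNReal.tendsto_nhds hc).1 hm ε (pos_iff_ne_zero.2 hε))
  filter_upwards [Metric.ball_mem_nhds c hη] with t ht
  have hr : ∀ r ∈ Set.uIoc c t, m r ∈ Set.Icc (m c - ε) (m c + ε) := by
    intro r hr
    refine h (lt_of_le_of_lt ?_ (Metric.mem_ball.1 ht))
    rw [dist_comm r c, dist_comm t c, Real.dist_eq, Real.dist_eq, abs_sub_comm c r, abs_sub_comm c t]
    exact Set.abs_sub_left_of_mem_uIcc (Set.uIoc_subset_uIcc hr)
  have hconst : ∀ a : ℝ≥0∞, ∫⁻ _ in Set.uIoc c t, a = ENNReal.ofReal |t - c| * a := by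
    intro a
    rw [setLIntegral_const, Real.volume_uIoc, mul_comm]
  constructor
  · rw [← hconst]
    exact setLIntegral_mono measurable_const fun r h => (hr r h).2
  · rw [← hconst, ← hconst, ← lintegral_add_right _ measurable_const]
    exact setLIntegral_mono' measurableSet_uIoc fun r h => tsub_le_iff_right.1 (hr r h).1

/-! ### Thin shells in a single chart -/

section Local

variable {E : Type*} [NormedAddCommGroup E] [InnerProductSpace ℝ E] [FiniteDimensional ℝ E]
  [MeasurableSpace E] [BorelSpace E]

/-- The volume between nearby level sets, weighted by a function supported in a region where `V` is
almost linear, is approximately given by the surface integral of `‖∇ V‖⁻¹`. -/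
theorem eventually_setLIntegral_between_levels {V : E → ℝ} {g : E} {X U : Set E} {δ κ : ℝ≥0}
    (hκ : 1 ≤ κ) (hU : IsOpen U) (hUX : U ⊆ X)
    (hV : ApproximatesLinearOn V (InnerProductSpace.toDual ℝ E g) U δ) (hg : g ≠ 0)
    (hδ : (δ : ℝ) ≤ (1 - (κ : ℝ)⁻¹) * ‖g‖)
    (hw : ∀ x ∈ U, ‖g‖ₑ⁻¹ ≤ κ * ‖∇ V x‖ₑ⁻¹ ∧ ‖∇ V x‖ₑ⁻¹ ≤ κ * ‖g‖ₑ⁻¹)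
    {φ : E → ℝ} (hφ : Continuous φ) (hφs : HasCompactSupport φ) (hφU : tsupport φ ⊆ U)
    (hφ0 : ∀ x, 0 ≤ φ x) (c : ℝ) :
    ∫⁻ x in X ∩ V ⁻¹' {c}, ENNReal.ofReal (φ x) ∂μHE[finrank ℝ E - 1] ≠ ∞ ∧
    ∀ ε : ℝ≥0∞, ε ≠ 0 → ∀ᶠ t in 𝓝 c,
      ∫⁻ x in X ∩ V ⁻¹' Set.uIoc c t, ENNReal.ofReal (φ x) ∂μHE[finrank ℝ E] ≤
        ENNReal.ofReal |t - c| * ((κ : ℝ≥0∞) ^ (2 * finrank ℝ E) *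
          ∫⁻ x in X ∩ V ⁻¹' {c}, ENNReal.ofReal (φ x) * ‖∇ V x‖ₑ⁻¹ ∂μHE[finrank ℝ E - 1] + ε) ∧
      ENNReal.ofReal |t - c| *
          ∫⁻ x in X ∩ V ⁻¹' {c}, ENNReal.ofReal (φ x) * ‖∇ V x‖ₑ⁻¹ ∂μHE[finrank ℝ E - 1] ≤
        (κ : ℝ≥0∞) ^ (2 * finrank ℝ E) *
          ∫⁻ x in X ∩ V ⁻¹' Set.uIoc c t, ENNReal.ofReal (φ x) ∂μHE[finrank ℝ E] +
        ENNReal.ofReal |t - c| * ε := by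
  have : Nontrivial E := ⟨⟨g, 0, hg⟩⟩
  have hn : 1 ≤ finrank ℝ E := finrank_pos
  set n := finrank ℝ E
  have hΦ := biLipschitzOn_straighten hκ hV hg hδ
  set Φ := straighten V g
  obtain ⟨ψ, hψ, hψs, hψ0, hψΦ, hψU⟩ :=
    exists_continuous_comp_straighten hκ hU hV hg hδ hφ hφs hφU hφ0
  obtain ⟨hmc, hmtop⟩ := continuous_setLIntegral_hyperplane hg hψ hψs hψ0
  set m : ℝ → ℝ≥0∞ := fun r => ∫⁻ y in {y | ⟪g, y⟫ = r}, ENNReal.ofReal (ψ y) ∂μHE[n - 1] with hm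
  have hψm : Measurable fun y => ENNReal.ofReal (ψ y) := hψ.measurable.ennreal_ofReal
  have hφU0 : ∀ x ∉ U, φ x = 0 := fun x hx =>
    image_eq_zero_of_notMem_tsupport fun h => hx (hφU h)
  have hΦU : MeasurableSet (Φ '' U) :=
    hU.measurableSet.image_of_continuousOn_injOn hΦ.1.continuousOn hΦ.injOn
  have hmeas : ∀ B : Set ℝ, MeasurableSet B → MeasurableSet (U ∩ V ⁻¹' B) := by
    intro B hB
    have hVc : ContinuousOn V U := hV.continuousOn
    have : MeasurableSet ((↑) ⁻¹' (V ⁻¹' B) : Set U) :=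
      (continuousOn_iff_continuous_domRestrict.1 hVc).measurable hB
    rw [← Subtype.image_preimage_coe]
    exact hU.measurableSet.subtype_image this
  have hchart : ∀ (k : ℕ) (B : Set ℝ) (f : E → ℝ≥0∞), (∀ x ∉ U, f x = 0) →
      ∫⁻ x in X ∩ V ⁻¹' B, f x ∂μHE[k] = ∫⁻ x in U ∩ V ⁻¹' B, f x ∂μHE[k] := by
    intro k B f hf
    rw [setLIntegral_eq_of_eq_zero_off hU.measurableSet _ hf, ← Set.inter_assoc,
      Set.inter_eq_left.2 hUX]
  have hφE0 : ∀ x ∉ U, ENNReal.ofReal (φ x) = 0 := fun x hx => by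
    rw [hφU0 x hx, ENNReal.ofReal_zero]
  have hred : ∀ (k : ℕ) (B : Set ℝ), MeasurableSet B →
      ∫⁻ x in X ∩ V ⁻¹' B, ENNReal.ofReal (φ x) ∂μHE[k] =
        ∫⁻ x in U ∩ V ⁻¹' B, ENNReal.ofReal (ψ (Φ x)) ∂μHE[k] := by
    intro k B hB
    rw [hchart k B _ hφE0]
    refine setLIntegral_congr_fun (hmeas B hB) fun x hx => ?_
    simp only [Φ, hψΦ x hx.1]
  have himg : ∀ B : Set ℝ, Φ '' (U ∩ V ⁻¹' B) = Φ '' U ∩ {y | ⟪g, y⟫ ∈ B} := by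
    intro B
    ext y
    constructor
    · rintro ⟨x, ⟨hx, h⟩, rfl⟩
      exact ⟨⟨x, hx, rfl⟩, by simpa [Φ, inner_straighten V hg] using h⟩
    · rintro ⟨⟨x, hx, rfl⟩, h⟩
      exact ⟨x, ⟨hx, by simpa [Φ, inner_straighten V hg] using h⟩, rfl⟩
  have hpush : ∀ (k : ℕ) (B : Set ℝ),
      ∫⁻ y in Φ '' (U ∩ V ⁻¹' B), ENNReal.ofReal (ψ y) ∂μHE[k] =
        ∫⁻ y in {y | ⟪g, y⟫ ∈ B}, ENNReal.ofReal (ψ y) ∂μHE[k] := by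
    intro k B
    rw [himg, ← setLIntegral_eq_of_eq_zero_off hΦU]
    intro y hy
    rw [hψU y hy, ENNReal.ofReal_zero]
  have hFub : ∀ B : Set ℝ, MeasurableSet B →
      ∫⁻ y in {y | ⟪g, y⟫ ∈ B}, ENNReal.ofReal (ψ y) ∂μHE[n] = ‖g‖ₑ⁻¹ * ∫⁻ r in B, m r := by
    intro B hB
    have hBm : MeasurableSet {y : E | ⟪g, y⟫ ∈ B} :=
      (continuous_const.inner continuous_id).measurable hB
    rw [← lintegral_indicator hBm,
      lintegral_eq_lintegral_hyperplane hg (hψm.indicator hBm), ← lintegral_indicator hB]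
    congr 2 with r
    have hr : MeasurableSet {y : E | ⟪g, y⟫ = r} :=
      (continuous_const.inner continuous_id).measurable (measurableSet_singleton r)
    by_cases hrB : r ∈ B
    · rw [Set.indicator_of_mem hrB]
      refine setLIntegral_congr_fun hr fun y (hy : ⟪g, y⟫ = r) => ?_
      exact Set.indicator_of_mem (s := {y | ⟪g, y⟫ ∈ B}) (by simpa [hy] using hrB) _
    · rw [Set.indicator_of_notMem hrB]
      refine setLIntegral_eq_zero hr fun y (hy : ⟪g, y⟫ = r) => ?_
      exact Set.indicator_of_notMem (s := {y | ⟪g, y⟫ ∈ B}) (by simpa [hy] using hrB) _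
  set S := ∫⁻ x in X ∩ V ⁻¹' {c}, ENNReal.ofReal (φ x) ∂μHE[n - 1] with hS
  set J := ∫⁻ x in X ∩ V ⁻¹' {c}, ENNReal.ofReal (φ x) * ‖∇ V x‖ₑ⁻¹ ∂μHE[n - 1] with hJ
  have hsing : {y : E | ⟪g, y⟫ ∈ ({c} : Set ℝ)} = {y | ⟪g, y⟫ = c} := rfl
  -- `m c` is the straightened counterpart of the surface integral `S`; since `‖∇ V‖` is nearly
  -- `‖g‖` on `U`, `J` is comparable to `‖g‖ₑ⁻¹ * S`.
  have hmS : m c ≤ (κ : ℝ≥0∞) ^ (n - 1) * S := by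
    rw [hS, hred _ _ (measurableSet_singleton c), hm]
    simp only
    rw [← hsing, ← hpush]
    exact (hΦ.mono Set.inter_subset_left).setLIntegral_image_le
      (hmeas _ (measurableSet_singleton c)) _ hψm
  have hSm : S ≤ (κ : ℝ≥0∞) ^ (n - 1) * m c := by
    rw [hS, hred _ _ (measurableSet_singleton c), hm]
    simp only
    rw [← hsing, ← hpush]
    exact (hΦ.mono Set.inter_subset_left).setLIntegral_comp_le
      (hmeas _ (measurableSet_singleton c)) _ hψm
  have hg0 : ‖g‖ₑ ≠ 0 := by simpa using hg
  have hgi : ‖g‖ₑ⁻¹ ≠ ∞ := ENNReal.inv_ne_top.2 hg0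
  have hUc : MeasurableSet (U ∩ V ⁻¹' {c}) := hmeas _ (measurableSet_singleton c)
  have hJU : J = ∫⁻ x in U ∩ V ⁻¹' {c}, ENNReal.ofReal (φ x) * ‖∇ V x‖ₑ⁻¹ ∂μHE[n - 1] :=
    hchart _ _ _ fun x hx => by rw [hφE0 x hx, zero_mul]
  have hSU : S = ∫⁻ x in U ∩ V ⁻¹' {c}, ENNReal.ofReal (φ x) ∂μHE[n - 1] := hchart _ _ _ hφE0
  have hJS : J ≤ κ * ‖g‖ₑ⁻¹ * S := by
    rw [hJU, hSU, ← lintegral_const_mul' _ _ (ENNReal.mul_ne_top ENNReal.coe_ne_top hgi)]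
    refine setLIntegral_mono' hUc fun x hx => ?_
    rw [mul_comm]
    gcongr
    exact (hw x hx.1).2
  have hSJ : ‖g‖ₑ⁻¹ * S ≤ κ * J := by
    rw [hJU, hSU, ← lintegral_const_mul' _ _ hgi, ← lintegral_const_mul' _ _ ENNReal.coe_ne_top]
    refine setLIntegral_mono' hUc fun x hx => ?_
    rw [mul_left_comm, mul_comm]
    gcongr
    exact (hw x hx.1).1
  refine ⟨ne_top_of_le_ne_top (ENNReal.mul_ne_top (by finiteness) (hmtop c)) hSm, fun ε hε => ?_⟩
  have hA0 : (κ : ℝ≥0∞) ^ n * ‖g‖ₑ⁻¹ ≠ 0 := by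
    refine mul_ne_zero (pow_ne_zero _ ?_) (by simp)
    exact ENNReal.coe_ne_zero.2 (zero_lt_one.trans_le hκ).ne'
  have hAt : (κ : ℝ≥0∞) ^ n * ‖g‖ₑ⁻¹ ≠ ∞ := ENNReal.mul_ne_top (by finiteness) hgi
  -- Chosen so that after multiplication by the volume distortion and the Fubini factor the error is
  -- exactly `ε`.
  set ε' := ε / ((κ : ℝ≥0∞) ^ n * ‖g‖ₑ⁻¹) with hε'
  have hεε : (κ : ℝ≥0∞) ^ n * ‖g‖ₑ⁻¹ * ε' = ε := ENNReal.mul_div_cancel hA0 hAt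
  -- The exponent is `n` for volume, `n - 1` for surface measure and `1` for replacing `‖g‖` by `‖∇
  -- V‖`; the truncated subtraction uses `n ≥ 1`.
  have hpow : (κ : ℝ≥0∞) ^ (2 * n) = (κ : ℝ≥0∞) ^ n * (κ : ℝ≥0∞) ^ (n - 1) * κ := by
    rw [mul_assoc, ← pow_succ, Nat.sub_add_cancel hn, ← pow_add, two_mul]
  filter_upwards [eventually_setLIntegral_uIoc hmc.continuousAt (hmtop c)
    (ENNReal.div_ne_zero.2 ⟨hε, hAt⟩ : ε' ≠ 0)] with t ht
  have hB : MeasurableSet (Set.uIoc c t) := measurableSet_uIoc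
  set Q := ∫⁻ x in X ∩ V ⁻¹' Set.uIoc c t, ENNReal.ofReal (φ x) ∂μHE[n] with hQ
  have hQm : Q ≤ (κ : ℝ≥0∞) ^ n * (‖g‖ₑ⁻¹ * ∫⁻ r in Set.uIoc c t, m r) := by
    rw [hQ, hred _ _ hB, ← hFub _ hB, ← hpush]
    exact (hΦ.mono Set.inter_subset_left).setLIntegral_comp_le (hmeas _ hB) _ hψm
  have hmQ : ‖g‖ₑ⁻¹ * ∫⁻ r in Set.uIoc c t, m r ≤ (κ : ℝ≥0∞) ^ n * Q := by
    rw [hQ, hred _ _ hB, ← hFub _ hB, ← hpush]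
    exact (hΦ.mono Set.inter_subset_left).setLIntegral_image_le (hmeas _ hB) _ hψm
  set T := ENNReal.ofReal |t - c|
  constructor
  · calc Q ≤ (κ : ℝ≥0∞) ^ n * (‖g‖ₑ⁻¹ * (T * (((κ : ℝ≥0∞) ^ (n - 1) * S) + ε'))) := by
          refine hQm.trans ?_
          gcongr
          exact ht.1.trans (by gcongr)
      _ = T * ((κ : ℝ≥0∞) ^ n * (κ : ℝ≥0∞) ^ (n - 1) * (‖g‖ₑ⁻¹ * S) +
            (κ : ℝ≥0∞) ^ n * ‖g‖ₑ⁻¹ * ε') := by ring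
      _ ≤ T * ((κ : ℝ≥0∞) ^ n * (κ : ℝ≥0∞) ^ (n - 1) * (κ * J) + ε) := by
          rw [hεε]; gcongr
      _ = _ := by rw [hpow]; ring
  · calc T * J ≤ T * (κ * ‖g‖ₑ⁻¹ * ((κ : ℝ≥0∞) ^ (n - 1) * m c)) := by
          gcongr; exact hJS.trans (by gcongr)
      _ = κ * (κ : ℝ≥0∞) ^ (n - 1) * (‖g‖ₑ⁻¹ * (T * m c)) := by ring
      _ ≤ κ * (κ : ℝ≥0∞) ^ (n - 1) * (‖g‖ₑ⁻¹ * ((∫⁻ r in Set.uIoc c t, m r) + T * ε')) := by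
          gcongr; exact ht.2
      _ = κ * (κ : ℝ≥0∞) ^ (n - 1) * (‖g‖ₑ⁻¹ * ∫⁻ r in Set.uIoc c t, m r) +
            T * (κ * (κ : ℝ≥0∞) ^ (n - 1) * ‖g‖ₑ⁻¹ * ε') := by ring
      _ ≤ κ * (κ : ℝ≥0∞) ^ (n - 1) * ((κ : ℝ≥0∞) ^ n * Q) + T * ε := by
          gcongr
          rw [← pow_succ', Nat.sub_add_cancel hn, hεε]
      _ = _ := by rw [hpow]; ring

end Local

/-! ### Shells around a compact regular level set -/

section Global

variable {E : Type*} [NormedAddCommGroup E] [InnerProductSpace ℝ E]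

/-- Near a regular point a continuously differentiable function is almost linear. -/
theorem ContDiffAt.exists_open_approximatesLinearOn [CompleteSpace E] {V : E → ℝ} {x : E}
    (hV : ContDiffAt ℝ 1 V x) (hg : ∇ V x ≠ 0) {X : Set E} (hX : X ∈ 𝓝 x) {κ : ℝ≥0} (hκ : 1 < κ) :
    ∃ U : Set E, IsOpen U ∧ x ∈ U ∧ U ⊆ X ∧
      (∃ δ : ℝ≥0, (δ : ℝ) ≤ (1 - (κ : ℝ)⁻¹) * ‖∇ V x‖ ∧
        ApproximatesLinearOn V (InnerProductSpace.toDual ℝ E (∇ V x)) U δ) ∧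
      ∀ y ∈ U, ‖∇ V x‖ₑ⁻¹ ≤ κ * ‖∇ V y‖ₑ⁻¹ ∧ ‖∇ V y‖ₑ⁻¹ ≤ κ * ‖∇ V x‖ₑ⁻¹ := by
  have hκ0 : 0 < κ := zero_lt_one.trans hκ
  have hη : 0 < 1 - κ⁻¹ := tsub_pos_of_lt (inv_lt_one_of_one_lt₀ hκ)
  have hgrad : HasStrictFDerivAt V (InnerProductSpace.toDual ℝ E (∇ V x)) x := by
    have h := hV.hasStrictFDerivAt one_ne_zero
    simpa [gradient] using h
  obtain ⟨U₁, hU₁, happ⟩ := hgrad.approximates_deriv_on_nhds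
    (c := (1 - κ⁻¹) * ‖∇ V x‖₊) (Or.inr (mul_pos hη (by simpa using hg)))
  have hcont : ContinuousAt (fun y => ‖∇ V y‖ₑ) x := by
    have h1 : ContinuousAt (fderiv ℝ V) x := (hV.fderiv_right (m := 0) le_rfl).continuousAt
    have h2 : ContinuousAt (fun y => ∇ V y) x :=
      (InnerProductSpace.toDual ℝ E).symm.continuous.continuousAt.comp h1
    exact continuous_enorm.continuousAt.comp h2
  have hg0 : ‖∇ V x‖ₑ ≠ 0 := by simpa using hg
  have hκE : (1 : ℝ≥0∞) < κ := by exact_mod_cast hκ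
  have hκE0 : (κ : ℝ≥0∞) ≠ 0 := by exact_mod_cast hκ0.ne'
  have hlt1 : ‖∇ V x‖ₑ < κ * ‖∇ V x‖ₑ := by
    simpa using (ENNReal.mul_lt_mul_iff_left hg0 enorm_ne_top).2 hκE
  have hlt2 : (κ : ℝ≥0∞)⁻¹ * ‖∇ V x‖ₑ < ‖∇ V x‖ₑ := by
    simpa using (ENNReal.mul_lt_mul_iff_left hg0 enorm_ne_top).2 (ENNReal.inv_lt_one.2 hκE)
  obtain ⟨U, hUsub, hUo, hxU⟩ := mem_nhds_iff.1 (inter_mem (inter_mem hU₁ hX)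
    (inter_mem (hcont.eventually_lt_const hlt1) (hcont.eventually_const_lt hlt2)))
  refine ⟨U, hUo, hxU, fun y hy => (hUsub hy).1.2, ⟨_, ?_, happ.mono_set fun y hy =>
    (hUsub hy).1.1⟩, fun y hy => ?_⟩
  · rw [NNReal.coe_mul, NNReal.coe_sub (inv_le_one_of_one_le₀ hκ.le)]
    simp
  · have h1 : ‖∇ V y‖ₑ < κ * ‖∇ V x‖ₑ := (hUsub hy).2.1
    have h2 : (κ : ℝ≥0∞)⁻¹ * ‖∇ V x‖ₑ < ‖∇ V y‖ₑ := (hUsub hy).2.2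
    constructor
    · have := ENNReal.inv_le_inv.2 h1.le
      rw [ENNReal.mul_inv (Or.inl hκE0) (Or.inl ENNReal.coe_ne_top)] at this
      calc ‖∇ V x‖ₑ⁻¹ = κ * ((κ : ℝ≥0∞)⁻¹ * ‖∇ V x‖ₑ⁻¹) := by
            rw [← mul_assoc, ENNReal.mul_inv_cancel hκE0 ENNReal.coe_ne_top, one_mul]
        _ ≤ _ := by gcongr
    · have := ENNReal.inv_le_inv.2 h2.le
      rwa [ENNReal.mul_inv (Or.inr enorm_ne_top) (Or.inr hg0), inv_inv] at this

variable [FiniteDimensional ℝ E] [MeasurableSpace E] [BorelSpace E]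

/-- The surface measure of a compact regular level set is finite, and the volume between it and a
nearby level set is approximately given by the surface integral of `‖∇ V‖⁻¹`. -/
theorem eventually_measure_between_levels {V : E → ℝ} {X : Set E} {c : ℝ}
    (hK : IsCompact (X ∩ V ⁻¹' {c}))
    (hnear : ∀ W : Set E, IsOpen W → X ∩ V ⁻¹' {c} ⊆ W →
      ∀ᶠ t in 𝓝 c, X ∩ V ⁻¹' Set.uIoc c t ⊆ W)
    (hmeas : ∀ᶠ t in 𝓝 c, MeasurableSet (X ∩ V ⁻¹' Set.uIoc c t))
    (hreg : ∀ x ∈ X ∩ V ⁻¹' {c}, X ∈ 𝓝 x ∧ ContDiffAt ℝ 1 V x ∧ ∇ V x ≠ 0)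
    {κ : ℝ≥0} (hκ : 1 < κ) :
    μHE[finrank ℝ E - 1] (X ∩ V ⁻¹' {c}) ≠ ∞ ∧
    ∀ ε : ℝ≥0∞, ε ≠ 0 → ∀ᶠ t in 𝓝 c,
      μHE[finrank ℝ E] (X ∩ V ⁻¹' Set.uIoc c t) ≤
        ENNReal.ofReal |t - c| * ((κ : ℝ≥0∞) ^ (2 * finrank ℝ E) *
          ∫⁻ x in X ∩ V ⁻¹' {c}, ‖∇ V x‖ₑ⁻¹ ∂μHE[finrank ℝ E - 1] + ε) ∧
      ENNReal.ofReal |t - c| * ∫⁻ x in X ∩ V ⁻¹' {c}, ‖∇ V x‖ₑ⁻¹ ∂μHE[finrank ℝ E - 1] ≤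
        (κ : ℝ≥0∞) ^ (2 * finrank ℝ E) * μHE[finrank ℝ E] (X ∩ V ⁻¹' Set.uIoc c t) +
        ENNReal.ofReal |t - c| * ε := by
  set n := finrank ℝ E
  choose! U hUo hxU hUX hUapp hUw using fun x hx =>
    (hreg x hx).2.1.exists_open_approximatesLinearOn (hreg x hx).2.2 (hreg x hx).1 hκ
  choose! δ hδ happ using hUapp
  obtain ⟨s, hsK, hs⟩ := hK.elim_nhds_subcover U fun x hx => (hUo x hx).mem_nhds (hxU x hx)
  -- The partition of unity must sum to one on whole shells, not just on the level set: the interior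
  -- of `L` contains every shell with `t` close to `c`.
  obtain ⟨L, hL, hKL, hLU⟩ := exists_compact_between hK
    (isOpen_biUnion fun x hx => hUo x (hsK x hx)) hs
  let e := s.equivFin
  obtain ⟨φ, hφU, hφ1, hφI, hφs⟩ := exists_continuous_sum_one_of_isOpen_isCompact
    (s := fun i => U (e.symm i)) (fun i => hUo _ (hsK _ (e.symm i).2)) hL (by
      refine hLU.trans (Set.iUnion₂_subset fun x hx y hy => Set.mem_iUnion.2 ⟨e ⟨x, hx⟩, ?_⟩)
      simpa using hy)
  have hloc := fun i => eventually_setLIntegral_between_levels hκ.le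
    (hUo _ (hsK _ (e.symm i).2)) (hUX _ (hsK _ (e.symm i).2)) (happ _ (hsK _ (e.symm i).2))
    (hreg _ (hsK _ (e.symm i).2)).2.2 (hδ _ (hsK _ (e.symm i).2)) (hUw _ (hsK _ (e.symm i).2))
    (φ i).continuous (hφs i) (hφU i) (fun x => (hφI i x).1) c
  have hφm : ∀ i, Measurable fun x => ENNReal.ofReal (φ i x) := fun i =>
    (φ i).continuous.measurable.ennreal_ofReal
  have hwm : Measurable fun x => ‖∇ V x‖ₑ⁻¹ := by
    have : Measurable fun x => ∇ V x :=
      (InnerProductSpace.toDual ℝ E).symm.continuous.measurable.comp (measurable_fderiv ℝ V)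
    exact this.enorm.inv
  have hsum : ∀ x ∈ interior L, ∑ i, ENNReal.ofReal (φ i x) = 1 := by
    intro x hx
    rw [← ENNReal.ofReal_sum_of_nonneg fun i _ => (hφI i x).1]
    have := hφ1 (interior_subset hx)
    simp only [Finset.sum_apply, Pi.one_apply] at this
    rw [this, ENNReal.ofReal_one]
  have hKm : MeasurableSet (X ∩ V ⁻¹' {c}) := hK.isClosed.measurableSet
  have hpart : ∀ (k : ℕ) (S : Set E), MeasurableSet S → S ⊆ interior L →
      ∑ i, ∫⁻ x in S, ENNReal.ofReal (φ i x) ∂μHE[k] = μHE[k] S := by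
    intro k S hS hSL
    rw [← lintegral_finsetSum _ fun i _ => hφm i, ← setLIntegral_one]
    exact setLIntegral_congr_fun hS fun x hx => hsum x (hSL hx)
  have hJ : ∑ i, ∫⁻ x in X ∩ V ⁻¹' {c}, ENNReal.ofReal (φ i x) * ‖∇ V x‖ₑ⁻¹ ∂μHE[n - 1] =
      ∫⁻ x in X ∩ V ⁻¹' {c}, ‖∇ V x‖ₑ⁻¹ ∂μHE[n - 1] := by
    have hφw : ∀ i, Measurable fun x => ENNReal.ofReal (φ i x) * ‖∇ V x‖ₑ⁻¹ := fun i =>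
      (hφm i).mul hwm
    rw [← lintegral_finsetSum _ fun i _ => hφw i]
    refine setLIntegral_congr_fun hKm fun x hx => ?_
    rw [← Finset.sum_mul, hsum x (hKL hx), one_mul]
  constructor
  · rw [← hpart _ _ hKm hKL]
    exact ENNReal.sum_ne_top.2 fun i _ => (hloc i).1
  · intro ε hε
    -- The error is shared among the charts; the `+ 1` keeps the divisor nonzero for an empty cover.
    have hε' : ε / ((s.card + 1 : ℕ) : ℝ≥0∞) ≠ 0 :=
      ENNReal.div_ne_zero.2 ⟨hε, ENNReal.natCast_ne_top _⟩
    have hεsum : ∑ _i : Fin s.card, ε / ((s.card + 1 : ℕ) : ℝ≥0∞) ≤ ε := by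
      rw [Finset.sum_const, Finset.card_univ, Fintype.card_fin, nsmul_eq_mul]
      calc _ ≤ ((s.card + 1 : ℕ) : ℝ≥0∞) * (ε / ((s.card + 1 : ℕ) : ℝ≥0∞)) := by
            gcongr; omega
        _ ≤ ε := ENNReal.mul_div_le
    filter_upwards [eventually_all.2 fun i => (hloc i).2 _ hε',
      hnear _ isOpen_interior hKL, hmeas] with t ht htL htm
    constructor
    · rw [← hpart _ _ htm htL, ← hJ, Finset.mul_sum]
      refine (Finset.sum_le_sum fun i _ => (ht i).1).trans ?_
      rw [← Finset.mul_sum, Finset.sum_add_distrib]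
      gcongr
    · rw [← hpart _ _ htm htL, ← hJ, Finset.mul_sum, Finset.mul_sum]
      refine (Finset.sum_le_sum fun i _ => (ht i).2).trans ?_
      rw [Finset.sum_add_distrib, ← Finset.mul_sum (f := fun _ => ε / _)]
      gcongr

end Global

/-- Eventually `R` lies between `(j - (κ - 1)) / κ ^ N` and `κ ^ N * j + (κ - 1)`, and both tend to
`j` as `κ` decreases to `1`. The one parameter `κ` controls both the distortion and the additive
error. -/
theorem tendsto_of_forall_factor {α : Type*} {l : Filter α} {R : α → ℝ} {j : ℝ} (N : ℕ)
    (h : ∀ κ : ℝ≥0, 1 < κ → ∀ᶠ t in l,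
      R t ≤ (κ : ℝ) ^ N * j + (κ - 1) ∧ j ≤ (κ : ℝ) ^ N * R t + (κ - 1)) :
    Tendsto R l (𝓝 j) := by
  have hup : Tendsto (fun κ : ℝ≥0 => (κ : ℝ) ^ N * j + (κ - 1)) (𝓝[>] 1) (𝓝 j) := by
    have : Continuous fun κ : ℝ≥0 => (κ : ℝ) ^ N * j + (κ - 1) := by fun_prop
    have := this.tendsto 1
    simp only [NNReal.coe_one, one_pow, one_mul, sub_self, add_zero] at this
    exact this.mono_left nhdsWithin_le_nhds
  have hlow : Tendsto (fun κ : ℝ≥0 => (j - (κ - 1)) / (κ : ℝ) ^ N) (𝓝[>] 1) (𝓝 j) := by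
    have : ContinuousAt (fun κ : ℝ≥0 => (j - (κ - 1)) / (κ : ℝ) ^ N) 1 :=
      ContinuousAt.div (by fun_prop) (by fun_prop) (by simp)
    have := this.tendsto
    simp only [NNReal.coe_one, one_pow, sub_self, sub_zero, div_one] at this
    exact this.mono_left nhdsWithin_le_nhds
  refine tendsto_order.2 ⟨fun a ha => ?_, fun a ha => ?_⟩
  · obtain ⟨κ, hκa, hκ⟩ := ((hlow.eventually_const_lt ha).and self_mem_nhdsWithin).exists
    have hκ1 : (1 : ℝ≥0) < κ := hκ
    have hpos : (0 : ℝ) < (κ : ℝ) ^ N := by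
      have : (0 : ℝ≥0) < κ := zero_lt_one.trans hκ1
      positivity
    filter_upwards [h κ hκ1] with t ht
    refine hκa.trans_le ((div_le_iff₀' hpos).2 ?_)
    linarith [ht.2]
  · obtain ⟨κ, hκa, hκ⟩ := ((hup.eventually_lt_const ha).and self_mem_nhdsWithin).exists
    filter_upwards [h κ hκ] with t ht
    exact ht.1.trans_lt hκa

/-! ### The derivative at a compact regular level -/

section SubLevel

variable {d : ℕ} {X : Set (EuclideanSpace ℝ (Fin d))} {V : EuclideanSpace ℝ (Fin d) → ℝ}

theorem levelSurface_eq (c : ℝ) : levelSurface X V c = X ∩ V ⁻¹' {c} := rfl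

/-- `X` need not be closed, so closedness is obtained inside the compact set `S_{c'}`. -/
theorem isCompact_levelSurface {c c' : ℝ} (hcc' : c < c') (hV : ContinuousOn V X)
    (hc' : IsCompact (subLevel X V c')) : IsCompact (levelSurface X V c) := by
  have hVc : ContinuousOn V (subLevel X V c') := hV.mono fun x hx => hx.1
  have : levelSurface X V c = subLevel X V c' ∩ V ⁻¹' {c} := by
    ext x
    constructor
    · rintro ⟨hx, h⟩
      exact ⟨⟨hx, h.le.trans hcc'.le⟩, h⟩
    · rintro ⟨hx, h⟩
      exact ⟨hx.1, h⟩
  rw [this]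
  exact hc'.of_isClosed_subset
    (hVc.preimage_isClosed_of_isClosed hc'.isClosed isClosed_singleton) Set.inter_subset_left

/-- The regions between a compact level set and nearby level sets shrink to the level set. -/
theorem eventually_between_levels_subset {c c' : ℝ} (hcc' : c < c') (hV : ContinuousOn V X)
    (hc' : IsCompact (subLevel X V c')) {W : Set (EuclideanSpace ℝ (Fin d))} (hW : IsOpen W)
    (hcW : levelSurface X V c ⊆ W) : ∀ᶠ t in 𝓝 c, X ∩ V ⁻¹' Set.uIoc c t ⊆ W := by
  -- The values of `V` on `S_{c'}` outside `W` form a compact set missing `c`, hence missing a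
  -- neighbourhood of `c`.
  have hK : IsCompact (V '' (subLevel X V c' \ W)) :=
    (hc'.diff hW).image_of_continuousOn (hV.mono fun x hx => hx.1.1)
  have hcK : c ∉ V '' (subLevel X V c' \ W) := by
    rintro ⟨x, hx, h⟩
    exact hx.2 (hcW ⟨hx.1.1, h⟩)
  obtain ⟨η, hη, hball⟩ := Metric.mem_nhds_iff.1
    (inter_mem (hK.isClosed.isOpen_compl.mem_nhds hcK) (Iio_mem_nhds hcc'))
  filter_upwards [Metric.ball_mem_nhds c hη] with t ht x hx
  have hr : V x ∈ Metric.ball c η := by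
    refine lt_of_le_of_lt ?_ (Metric.mem_ball.1 ht)
    rw [Real.dist_eq, Real.dist_eq]
    exact Set.abs_sub_left_of_mem_uIcc (Set.uIoc_subset_uIcc hx.2)
  by_contra hxW
  exact (hball hr).1 ⟨x, ⟨⟨hx.1, (hball hr).2.le⟩, hxW⟩, rfl⟩

/-- The unordered interval `uIoc c t` treats levels above and below `c` together, which yields a
two-sided derivative. -/
theorem slope_volumeReal_subLevel {K : ℝ≥0} (hLip : LipschitzOnWith K V X) (hX : MeasurableSet X)
    {c c' t : ℝ} (hcc' : c < c') (htc' : t < c') (htc : t ≠ c)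
    (hfin : volume (subLevel X V c') ≠ ∞) :
    slope (fun t => volume.real (subLevel X V t)) c t =
      volume.real (X ∩ V ⁻¹' Set.uIoc c t) / |t - c| := by
  rw [slope_def_field]
  rcases lt_or_gt_of_ne htc with h | h
  · rw [abs_of_neg (sub_neg.2 h), Set.uIoc_of_ge h.le, ← subLevel_sdiff_subLevel,
      ← volumeReal_subLevel_sub hLip hX h.le
        (measure_ne_top_of_subset (subLevel_mono hcc'.le) hfin), ← neg_div_neg_eq]
    ring
  · rw [abs_of_pos (sub_pos.2 h), Set.uIoc_of_le h.le, ← subLevel_sdiff_subLevel,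
      ← volumeReal_subLevel_sub hLip hX h.le
        (measure_ne_top_of_subset (subLevel_mono htc'.le) hfin)]

/-- At a compact regular level the surface measure is finite, and the volume of the sublevel sets is
differentiable, its derivative being the surface integral of `‖∇ V‖⁻¹`. -/
theorem hasDerivAt_volumeReal_subLevel {K : ℝ≥0} (hLip : LipschitzOnWith K V X)
    (hX : MeasurableSet X) {G c c' : ℝ} (hG : 0 < G) (hcc' : c < c')
    (hc' : IsCompact (subLevel X V c'))
    (hreg : ∀ x ∈ levelSurface X V c, X ∈ 𝓝 x ∧ ContDiffAt ℝ 1 V x)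
    (hgrad : ∀ x ∈ levelSurface X V c, G ≤ ‖∇ V x‖) :
    surfaceArea X V c ≠ ∞ ∧
    ∫⁻ x in levelSurface X V c, ‖∇ V x‖ₑ⁻¹ ∂μHE[d - 1] ≤
      ENNReal.ofReal G⁻¹ * surfaceArea X V c ∧
    HasDerivAt (fun t => volume.real (subLevel X V t))
      (∫⁻ x in levelSurface X V c, ‖∇ V x‖ₑ⁻¹ ∂μHE[d - 1]).toReal c := by
  have hfin : volume (subLevel X V c') ≠ ∞ := hc'.measure_lt_top.ne
  have hKc := isCompact_levelSurface hcc' hLip.continuousOn hc'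
  have hest := fun (κ : ℝ≥0) (hκ : 1 < κ) => eventually_measure_between_levels (κ := κ) hKc
    (fun W hW hcW => eventually_between_levels_subset hcc' hLip.continuousOn hc' hW hcW)
    (Eventually.of_forall fun t => hLip.measurableSet_inter_preimage hX measurableSet_uIoc)
    (fun x hx => ⟨(hreg x hx).1, (hreg x hx).2, norm_pos_iff.1 (hG.trans_le (hgrad x hx))⟩) hκ
  simp only [finrank_euclideanSpace_fin, EuclideanSpace.euclideanHausdorffMeasure_eq_volume,
    ← levelSurface_eq] at hest
  set J := ∫⁻ x in levelSurface X V c, ‖∇ V x‖ₑ⁻¹ ∂μHE[d - 1] with hJ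
  have harea : surfaceArea X V c ≠ ∞ := (hest 2 one_lt_two).1
  have hJle : J ≤ ENNReal.ofReal G⁻¹ * surfaceArea X V c := by
    rw [surfaceArea, ← setLIntegral_const]
    refine setLIntegral_mono' hKc.isClosed.measurableSet fun x hx => ?_
    rw [ENNReal.ofReal_inv_of_pos hG, ENNReal.inv_le_inv, ← ofReal_norm]
    exact ENNReal.ofReal_le_ofReal (hgrad x hx)
  have hJtop : J ≠ ∞ := ne_top_of_le_ne_top (ENNReal.mul_ne_top ENNReal.ofReal_ne_top harea) hJle
  -- The shell estimate is applied with error `κ - 1`, the form required by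
  -- `tendsto_of_forall_factor`.
  refine ⟨harea, hJle, hasDerivAt_iff_tendsto_slope.2 (tendsto_of_forall_factor (2 * d) ?_)⟩
  intro κ hκ
  have hκ' : (1 : ℝ) < κ := hκ
  have hε : ENNReal.ofReal (κ - 1) ≠ 0 := by simpa using hκ'
  filter_upwards [nhdsWithin_le_nhds ((hest κ hκ).2 _ hε), self_mem_nhdsWithin,
    nhdsWithin_le_nhds (Iio_mem_nhds hcc')] with t ht htc htc'
  have hpos : 0 < |t - c| := abs_pos.2 (sub_ne_zero.2 htc)
  have hQ : volume (X ∩ V ⁻¹' Set.uIoc c t) ≠ ∞ := by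
    refine measure_ne_top_of_subset (fun x hx => ?_) hfin
    exact ⟨hx.1, hx.2.2.trans (max_le hcc'.le (le_of_lt htc'))⟩
  rw [slope_volumeReal_subLevel hLip hX hcc' htc' htc hfin]
  have hκt : (κ : ℝ≥0∞) ^ (2 * d) ≠ ∞ := by finiteness
  constructor
  · have h := ENNReal.toReal_mono (by finiteness) ht.1
    rw [ENNReal.toReal_mul, ENNReal.toReal_add (by finiteness) (by finiteness), ENNReal.toReal_mul,
      ENNReal.toReal_pow, ENNReal.toReal_ofReal hpos.le, ENNReal.coe_toReal,
      ENNReal.toReal_ofReal (by linarith)] at h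
    exact (div_le_iff₀' hpos).2 h
  · have h := ENNReal.toReal_mono (by finiteness) ht.2
    rw [ENNReal.toReal_add (by finiteness) (by finiteness), ENNReal.toReal_mul, ENNReal.toReal_mul,
      ENNReal.toReal_mul, ENNReal.toReal_pow, ENNReal.toReal_ofReal hpos.le, ENNReal.coe_toReal,
      ENNReal.toReal_ofReal (by linarith), ← measureReal_def] at h
    rw [← mul_div_assoc, ← _root_.sub_le_iff_le_add, le_div_iff₀ hpos]
    linarith

end SubLevel

end GrowthOfSublevelSets

theorem mainTheorem2 (d : ℕ) (hd : 1 ≤ d)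
    (X : Set (EuclideanSpace ℝ (Fin d))) (hX : MeasurableSet X)
    (V : EuclideanSpace ℝ (Fin d) → ℝ) (hpos : PosDefOn X V)
    (K : ℝ≥0) (hLip : LipschitzOnWith K V X)
    (G : ℝ) (hG : 0 < G) :
    -- Lipschitz `V` with gradient bounded below between two levels `a < b`
    -- (at almost every point, the gradient being taken where it exists)
    (∀ a b : ℝ, 0 ≤ a → a < b →
      (∀ᵐ x ∂volume.restrict (subLevel X V b \ subLevel X V a),
        ∀ g, HasGradientWithinAt V g X x → G ≤ ‖g‖) →
      (∀ s t : ℝ, a ≤ s → s ≤ t → t ≤ b →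
        volume (subLevel X V t \ subLevel X V s) ≤
          ENNReal.ofReal G⁻¹ * ∫⁻ r in Set.Ioc s t, surfaceArea X V r) ∧
      (volume (subLevel X V b) ≠ ∞ →
        ∀ᵐ c ∂volume.restrict (Set.Ioo a b), GrowthBoundAt X V G c)) ∧
    -- every single level `c` near which `V` is continuously differentiable
    (∀ c : ℝ, 0 < c → (∃ c', c < c' ∧ IsCompact (subLevel X V c')) →
      (∀ x ∈ levelSurface X V c, X ∈ 𝓝 x ∧ ContDiffAt ℝ 1 V x) →
      (∀ x ∈ levelSurface X V c, G ≤ ‖∇ V x‖) →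
      surfaceArea X V c ≠ ∞ ∧ GrowthBoundAt X V G c ∧
      ((∀ x ∈ levelSurface X V c, ‖∇ V x‖ = G) →
        HasDerivAt (fun t => volume.real (subLevel X V t))
          (G⁻¹ * (surfaceArea X V c).toReal) c)) := by
  constructor
  · intro a b ha hab hg
    refine ⟨fun s t has hst htb => ?_, fun hfin => ae_growthBoundAt hLip hX hG ha hg hfin⟩
    rw [subLevel_sdiff_subLevel]
    refine volume_inter_preimage_le_lintegral_surfaceArea hLip hX hG measurableSet_Ioc
      (ae_restrict_of_ae_restrict_of_subset ?_ hg)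
    rw [subLevel_sdiff_subLevel]
    exact Set.inter_subset_inter_right _ (Set.preimage_mono (Set.Ioc_subset_Ioc has htb))
  · rintro c hc ⟨c', hcc', hc'⟩ hreg hgrad
    obtain ⟨harea, hle, hder⟩ := hasDerivAt_volumeReal_subLevel hLip hX hG hcc' hc' hreg hgrad
    refine ⟨harea, growthBoundAt_of_hasDerivAt hLip hX hG hc hcc' hc'.measure_lt_top.ne hder
      (ENNReal.ofReal_toReal_le.trans hle), fun heq => ?_⟩
    convert hder using 1
    have hm : MeasurableSet (levelSurface X V c) :=
      (isCompact_levelSurface hcc' hLip.continuousOn hc').isClosed.measurableSet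
    have hJ : ∫⁻ x in levelSurface X V c, ‖∇ V x‖ₑ⁻¹ ∂μHE[d - 1] =
        ENNReal.ofReal G⁻¹ * surfaceArea X V c := by
      rw [surfaceArea, ← setLIntegral_const]
      refine setLIntegral_congr_fun hm fun x hx => ?_
      rw [ENNReal.ofReal_inv_of_pos hG, ← heq x hx, ofReal_norm]
    rw [hJ, ENNReal.toReal_mul, ENNReal.toReal_ofReal (inv_nonneg.2 hG.le)]
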